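/- Throughout, $\log=\log_2$, inputs are $x\in\{1,2\}$, outputs are $a\in\{\pm1\}$ (identified with bits), vector inequalities are componentwise, and all random variables are discrete, with $\mathrm{TV}(\mu,\nu)=\frac12\sum_z|\mu(z)-\nu(z)|$. **Quantum behaviours.** $\mathcal Q\subset\mathbb R^4$ is the convex hull of the set of all $(\vec E,\vec\omega)=(E_1,E_2,\omega_1,\omega_2)$ for which there are a Hilbert space, two states (density operators) $\rho_1,\rho_2$, an observable $-1\le M\le 1$ and an energy observable $O$ (with an orthonormal eigenbasis, non-degenerate lowest eigenvalue $0$ and all other eigenvalues at least $1$) with $\mathrm{Tr}[\rho_xM]=E_x$ and $\mathrm{Tr}[\rho_xO]\le\omega_x$ for $x=1,2$. Put $\mathcal Q_{\vec\omega_{\rm pk}}=\{(\vec E,\vec\omega)\in\mathcal Q:\vec\omega\le\vec\omega_{\rm pk}\}$. **Protocol arguments.** Let $n\ge1$; let $p(x)>0$ be an input distribution on $\{1,2\}$; let $\vec 0\le\vec\omega_{\rm avg}\le\vec\omega_{\rm pk}\le\vec 1$; let $\epsilon_\omega\ge0$, $\epsilon_t,\epsilon_m,\epsilon_{Ext}>0$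 and $\epsilon=\epsilon_t+\epsilon_m+\epsilon_{Ext}+\epsilon_\omega$. Let $(\vec\alpha,\vec\beta,\vec\gamma)\in(\mathbb R^2)^3$ be a trade-off function, i.e. $\vec\gamma\le0$ and $$\alpha_1+\alpha_2+\vec\beta\cdot\vec E+\vec\gamma\cdot\vec\omega\le H(\vec E):=-\sum_{a,x}p(x)\tfrac{1+aE_x}{2}\log\tfrac{1+aE_x}{2}\quad\text{for all }(\vec E,\vec\omega)\in\mathcal Q_{\vec\omega_{\rm pk}}.$$ Put $\xi(a,x)=\frac1{p(x)}(\alpha_x+a\beta_x)$, $\xi^+=\max\xi$, $\xi^-=\min\xi$, $\bar\gamma=\gamma_1+\gamma_2$, $|A|=2$, $$V=\max\{(\xi^++\bar\gamma)^2,(\xi^-+\bar\gamma)^2\}+2\max\{-\log|A|\,(\bar\gamma+\xi^-),0\}+\tfrac{4|A|}{e^2}(\log_2e)^2,$$ $$t=\sqrt{2V}\sqrt{\tfrac{\log(1/\epsilon_t)}{n}}+\tfrac{\xi^+}{3}\tfrac{\log(1/\epsilon_t)}{n},$$ and assume that the error term satisfies $t\ge0$ (automatic if $\xi^+\ge0$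 and $\epsilon_t\le1$). Let $r\in\mathbb R$ be a threshold with $r-t\le1$, put $\sigma_h=n(r-t)-\log(1/\epsilon_m)$, and let $\mathcal E:\{0,1\}^n\times\{0,1\}^l\to\{0,1\}^\sigma$ be a strong extractor with parameters $(n,l,\sigma_h,\sigma,\epsilon_{Ext})$: for every $A$ on $\{0,1\}^n$ with $\max_a\Pr(A=a)\le2^{-\sigma_h}$ and an independent uniform seed $S$, the law of $(\mathcal E(A,S),S)$ is within total variation distance $\epsilon_{Ext}$ of uniform. **Device assumptions.** Let $\mu$ be the distribution of $(A^n,X^n,\Lambda)$ with $A^n\in\{\pm1\}^n$, $X^n\in\{1,2\}^n$ and $\Lambda$ the adversary's information, and let $W_i=(A^{i-1},X^{i-1})$. Assume that there are functions $\vec E_i(W_i,\Lambda)$, $\vec\omega_i(W_i,\Lambda)$ such that, for all $i=1,\dots,n$ and all values of $(W_i,\Lambda)$ of positive probability: $\mu_{X_i|W_i\Lambda}(x)=p(x)$; $\mu_{A_i|X_iW_i\Lambda}(a|x)=\frac12(1+aE_{x,i}(W_i,\Lambda))$; $(\vec E_i(W_i,\Lambda),\vec\omega_i(W_i,\Lambda))\in\mathcal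 Q$; and $\vec\omega_i(W_i,\Lambda)\le\vec\omega_{\rm pk}$. Assume moreover that $\Pr\big(\frac1n\sum_{i=1}^n\vec\omega_i(W_i,\Lambda)\le\vec\omega_{\rm avg}\big)\ge1-\epsilon_\omega$. **Theorem.** Let $\mathrm{Pass}$ be the event $\frac1n\sum_i\xi(A_i,X_i)+\vec\gamma\cdot\vec\omega_{\rm avg}\ge r$, let $\kappa=\Pr(\mathrm{Pass})$, and let $K=\mathcal E(A^n,S)$ with $S$ uniform on $\{0,1\}^l$ and independent of $(A^n,X^n,\Lambda)$. If $\kappa>0$, then $$\mathrm{TV}\big(\mu_{[KSX^n\Lambda|\mathrm{Pass}]},\ \mathrm{Unif}_{KS}\otimes\mu_{[X^n\Lambda|\mathrm{Pass}]}\big)\le\epsilon_{Ext}+\frac{\epsilon_\omega+\epsilon_t+\epsilon_m}{\kappa}\le\frac{\epsilon}{\kappa}.$$ In particular, the protocol is $\epsilon$-sound: $$\Pr(\mathrm{Pass})\cdot\mathrm{TV}\big(\mu_{[KSX^n\Lambda|\mathrm{Pass}]},\ \mathrm{Unif}_{KS}\otimes\mu_{[X^n\Lambda|\mathrm{Pass}]}\big)\le\epsilon,$$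 where the left side is read as $0$ if $\kappa=0$. -/

import Mathlib

open scoped InnerProductSpace

noncomputable section

namespace EnergyQRNG

/-! ### Discrete probability -/

/-- Probability of an event under a discrete distribution. -/
def prob {Ω : Type*} (μ : PMF Ω) (S : Set Ω) : ℝ := (μ.toOuterMeasure S).toReal

/-- Conditional probability `Pr(S | T)`; meaningful when `Pr(T) ≠ 0`. -/
def condProb {Ω : Type*} (μ : PMF Ω) (S T : Set Ω) : ℝ := prob μ (S ∩ T) / prob μ T

/-- Total variation distance of two discrete distributions given by their mass functions. -/
def TV {Ω : Type*} (f g : Ω → ℝ) : ℝ := (1 / 2) * ∑' z, |f z - g z|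

/-- Bit strings of length `k`. -/
abbrev Bits (k : ℕ) : Type := Fin k → Bool

/-- The mass of each point under the uniform distribution on a finite type. -/
def unifMass (α : Type*) [Fintype α] : ℝ := 1 / (Fintype.card α : ℝ)

/-- The joint law of a random variable with distribution `μ` and an independent uniform seed of
`l` bits. -/
def withSeed {Ω : Type*} (μ : PMF Ω) (l : ℕ) : PMF (Ω × Bits l) :=
  μ.bind fun o => (PMF.uniformOfFintype (Bits l)).map fun s => (o, s)

/-- Strong extractor with parameters `(n, l, k, m, ε)`: for every source on `n` bits of
min-entropy at least `k`, the pair (output, seed) is `ε`-close to uniform. -/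
def IsStrongExtractor {n l m : ℕ} (Ext : Bits n → Bits l → Bits m) (k ε : ℝ) : Prop :=
  ∀ μ : PMF (Bits n), (∀ a, prob μ {a} ≤ (2 : ℝ) ^ (-k)) →
    TV (fun z : Bits m × Bits l => prob (withSeed μ l) {q | Ext q.1 q.2 = z.1 ∧ q.2 = z.2})
      (fun _ => unifMass (Bits m × Bits l)) ≤ ε

/-! ### Quantum behaviours

The two inputs are indexed by `Fin 2`. Outputs are bits; `true` stands for `+1` and `false`
for `-1`. -/

/-- The numerical value of an output. -/
def sgn (a : Bool) : ℝ := if a then 1 else -1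

/-- A quantum representation of the behaviour `(E, ω)` on the Hilbert space `H`, without shared
randomness. The energy observable, which may be unbounded, is given by an orthonormal eigenbasis
`b` with eigenvalues `e`: `O (b j) = e j • b j`. Traces are computed in this basis. -/
structure QuantumRep (H : Type) [NormedAddCommGroup H] [InnerProductSpace ℂ H]
    [CompleteSpace H] (E ω : Fin 2 → ℝ) where
  /-- index set of the eigenbasis of the energy observable -/
  ι : Type
  /-- eigenbasis of the energy observable -/
  b : HilbertBasis ι ℂ H
  /-- eigenvalues of the energy observable -/
  e : ι → ℝ
  /-- the vacuum -/
  vac : ι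
  /-- the states sent by the source -/
  ρ : Fin 2 → H →L[ℂ] H
  /-- the measured observable -/
  M : H →L[ℂ] H
  energy_vac : e vac = 0
  energy_gap : ∀ j, j ≠ vac → 1 ≤ e j
  state_pos : ∀ x, (ρ x).IsPositive
  state_trace : ∀ x, HasSum (fun j => ⟪b j, ρ x (b j)⟫_ℂ) 1
  neg_one_le_M : (M + 1).IsPositive
  M_le_one : (1 - M).IsPositive
  corr : ∀ x, HasSum (fun j => ⟪b j, ρ x (M (b j))⟫_ℂ) (E x : ℂ)
  energy_summable : ∀ x, Summable fun j => e j * (⟪b j, ρ x (b j)⟫_ℂ).re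
  energy_le : ∀ x, ∑' j, e j * (⟪b j, ρ x (b j)⟫_ℂ).re ≤ ω x

/-- The set of quantum behaviours: convex combinations of behaviours with a quantum
representation. -/
def Q : Set ((Fin 2 → ℝ) × (Fin 2 → ℝ)) :=
  convexHull ℝ {B | ∃ (H : Type) (_ : NormedAddCommGroup H) (_ : InnerProductSpace ℂ H)
    (_ : CompleteSpace H), Nonempty (QuantumRep H B.1 B.2)}

/-- Quantum behaviours with energies bounded by `ωpk`. -/
def Qpk (ωpk : Fin 2 → ℝ) : Set ((Fin 2 → ℝ) × (Fin 2 → ℝ)) := {B | B ∈ Q ∧ B.2 ≤ ωpk}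

/-- Conditional Shannon entropy (in bits) of the output given the input, for the correlations
`E` and the input distribution `p`. -/
def H (p E : Fin 2 → ℝ) : ℝ :=
  -∑ a : Bool, ∑ x, p x * ((1 + sgn a * E x) / 2) * Real.logb 2 ((1 + sgn a * E x) / 2)

/-- Trade-off functions with max-peak energies `ωpk`. -/
def IsTradeoff (p ωpk α β γ : Fin 2 → ℝ) : Prop :=
  γ ≤ 0 ∧ ∀ B ∈ Qpk ωpk,
    ∑ x, α x + ∑ x, β x * B.1 x + ∑ x, γ x * B.2 x ≤ H p B.1

/-! ### The device used `n` times -/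

/-- Values of `(Aⁿ, Xⁿ, Λ)`. -/
abbrev Run (n : ℕ) (L : Type*) : Type _ := Bits n × (Fin n → Fin 2) × L

/-- The entries of a sequence strictly before round `i`. -/
def past {n : ℕ} {α : Type*} (i : Fin n) (u : Fin n → α) : Fin i → α :=
  fun j => u (j.castLE i.isLt.le)

/-- A pair of real numbers for each round `i`, depending on the past outputs and inputs
`W_i = (A^{i-1}, X^{i-1})` and on the adversary's information. -/
abbrev RoundFun (n : ℕ) (L : Type*) : Type _ :=
  (i : Fin n) → (Fin i → Bool) → (Fin i → Fin 2) → L → Fin 2 → ℝ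

/-- The event that `W_i = (a, x)` and `Λ = lam`. -/
def pastEvent {n : ℕ} {L : Type*} (i : Fin n) (a : Fin i → Bool) (x : Fin i → Fin 2) (lam : L) :
    Set (Run n L) :=
  {o | past i o.1 = a ∧ past i o.2.1 = x ∧ o.2.2 = lam}

/-- The assumptions on the distribution `μ` of `(Aⁿ, Xⁿ, Λ)`, with correlations `E` and
energies `ω` of the individual rounds. -/
structure DeviceAssumptions {n : ℕ} {L : Type*} (μ : PMF (Run n L)) (E ω : RoundFun n L)
    (p ωpk ωavg : Fin 2 → ℝ) (εω : ℝ) : Prop where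
  /-- inputs are drawn from `p`, independently of the past and of `Λ` -/
  input : ∀ i a x lam, prob μ (pastEvent i a x lam) ≠ 0 → ∀ x₀,
    condProb μ {o | o.2.1 i = x₀} (pastEvent i a x lam) = p x₀
  /-- the output of round `i` has correlations `E i` -/
  output : ∀ i a x lam x₀, prob μ ({o | o.2.1 i = x₀} ∩ pastEvent i a x lam) ≠ 0 → ∀ a₀,
    condProb μ {o | o.1 i = a₀} ({o | o.2.1 i = x₀} ∩ pastEvent i a x lam)
      = (1 + sgn a₀ * E i a x lam x₀) / 2
  /-- each round is a valid quantum behaviour -/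
  quantum : ∀ i a x lam, prob μ (pastEvent i a x lam) ≠ 0 → (E i a x lam, ω i a x lam) ∈ Q
  /-- max-peak assumption -/
  max_peak : ∀ i a x lam, prob μ (pastEvent i a x lam) ≠ 0 → ω i a x lam ≤ ωpk
  /-- max-average assumption -/
  max_avg : 1 - εω ≤ prob μ {o | ∀ x₀,
    (1 / (n : ℝ)) * ∑ i, ω i (past i o.1) (past i o.2.1) o.2.2 x₀ ≤ ωavg x₀}

/-! ### The protocol -/

/-- Arguments of the protocol. -/
structure Args where
  /-- number of rounds -/
  n : ℕ
  /-- length of the seed -/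
  l : ℕ
  /-- length of the final string -/
  σ : ℕ
  /-- input distribution -/
  p : Fin 2 → ℝ
  /-- max-peak energies -/
  ωpk : Fin 2 → ℝ
  /-- max-average energies -/
  ωavg : Fin 2 → ℝ
  /-- failure probability of the max-average assumption -/
  εω : ℝ
  /-- security parameter of the error term -/
  εt : ℝ
  /-- security parameter of the min-entropy -/
  εm : ℝ
  /-- security parameter of the extractor -/
  εExt : ℝ
  /-- trade-off function, constant part -/
  α : Fin 2 → ℝ
  /-- trade-off function, coefficients of the correlations -/
  β : Fin 2 → ℝ
  /-- trade-off function, coefficients of the energies -/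
  γ : Fin 2 → ℝ
  /-- threshold of the test -/
  r : ℝ
  /-- extractor -/
  ext : Bits n → Bits l → Bits σ

namespace Args

variable (P : Args)

/-- `ε = ε_t + ε_m + ε_Ext + ε_ω` -/
def ε : ℝ := P.εt + P.εm + P.εExt + P.εω

/-- The estimator `ξ(a, x)`. -/
def ξ (a : Bool) (x : Fin 2) : ℝ := 1 / P.p x * (P.α x + sgn a * P.β x)

/-- `ξ⁺` -/
def ξmax : ℝ := ⨆ z : Bool × Fin 2, P.ξ z.1 z.2

/-- `ξ⁻` -/
def ξmin : ℝ := ⨅ z : Bool × Fin 2, P.ξ z.1 z.2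

/-- `γ̄ = ∑ₓ γₓ` -/
def γbar : ℝ := ∑ x, P.γ x

/-- The constant `V`; the cardinality of the output alphabet is that of `Bool`. -/
def V : ℝ :=
  max ((P.ξmax + P.γbar) ^ 2) ((P.ξmin + P.γbar) ^ 2)
    + 2 * max (-(Real.logb 2 (Fintype.card Bool) * (P.γbar + P.ξmin))) 0
    + 4 * (Fintype.card Bool : ℝ) / Real.exp 1 ^ 2 * Real.logb 2 (Real.exp 1) ^ 2

/-- The error term `t`. -/
def t : ℝ :=
  √(2 * P.V) * √(Real.logb 2 (1 / P.εt) / P.n) + P.ξmax / 3 * (Real.logb 2 (1 / P.εt) / P.n)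

/-- The bound `σ_h` on the min-entropy. -/
def σh : ℝ := P.n * (P.r - √(2 * P.V) * √(Real.logb 2 (1 / P.εt) / P.n)
  - P.ξmax / 3 * (Real.logb 2 (1 / P.εt) / P.n) - Real.logb 2 (1 / P.εm) / P.n)

/-- Validity of the arguments of the protocol. -/
structure Valid : Prop where
  n_pos : 0 < P.n
  p_pos : ∀ x, 0 < P.p x
  p_sum : ∑ x, P.p x = 1
  avg_nonneg : 0 ≤ P.ωavg
  avg_le_pk : P.ωavg ≤ P.ωpk
  pk_le_one : P.ωpk ≤ 1
  εω_nonneg : 0 ≤ P.εω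
  εt_pos : 0 < P.εt
  εm_pos : 0 < P.εm
  εExt_pos : 0 < P.εExt
  tradeoff : IsTradeoff P.p P.ωpk P.α P.β P.γ
  threshold : P.r - P.t ≤ 1
  extractor : IsStrongExtractor P.ext P.σh P.εExt

/-- The event that the test is passed. -/
def pass (L : Type*) : Set (Run P.n L) :=
  {o | P.r ≤ (1 / (P.n : ℝ)) * ∑ i, P.ξ (o.1 i) (o.2.1 i) + ∑ x, P.γ x * P.ωavg x}

variable {L : Type*} (μ : PMF (Run P.n L))

/-- `κ = Pr(Pass)` -/
def κ : ℝ := prob μ (P.pass L)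

/-- Mass function of `(K, S, Xⁿ, Λ)` conditioned on `Pass`, where `K = ext(Aⁿ, S)` and the seed
`S` is uniform and independent of `(Aⁿ, Xⁿ, Λ)`. -/
def realMass (z : Bits P.σ × Bits P.l × (Fin P.n → Fin 2) × L) : ℝ :=
  condProb (withSeed μ P.l)
    {q | P.ext q.1.1 q.2 = z.1 ∧ q.2 = z.2.1 ∧ q.1.2 = z.2.2}
    {q | q.1 ∈ P.pass L}

/-- Mass function of the product of the uniform distribution of `(K, S)` with the distribution
of `(Xⁿ, Λ)` conditioned on `Pass`. -/
def idealMass (z : Bits P.σ × Bits P.l × (Fin P.n → Fin 2) × L) : ℝ :=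
  unifMass (Bits P.σ × Bits P.l) * condProb μ {o | o.2 = z.2.2} (P.pass L)

end Args

end EnergyQRNG

end

/-! Conditionally on the past and on `Λ`, the score of a round, which is `ξ` plus the energies
weighted by `γ` plus the logarithm of the probability of the output, has nonpositive mean by the
trade-off inequality, second moment at most `V`, and upper bound `ξ⁺`. Bernstein's inequality for
adapted processes therefore bounds by `ε_t` the probability that the total score exceeds `n t`. On
`Pass`, outside this event and the failure of the max-average assumption, the conditional
probability of the outputs given `(Xⁿ, Λ)` is then at most `2 ^ (-n (r - t)) = 2 ^ (-σ_h) ε_m`.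

To avoid conditioning on `Pass`, the extractor is applied to the unnormalized weights
`Pr(Aⁿ = a, Pass, good, (Xⁿ, Λ) = y)` for each `y`. If their sum is at least `ε_m Pr(y)`, they
normalize to a source of min-entropy `σ_h`; otherwise dropping them costs at most `ε_m Pr(y)`. -/

namespace EnergyQRNG

open Finset Real

/-! ### Bernstein's inequality -/

theorem monotone_sub_two_mul_exp : Monotone fun y : ℝ => (y - 2) * exp y + y + 2 := by
  have hderiv (y : ℝ) : HasDerivAt (fun y : ℝ => (y - 2) * exp y + y + 2)
      ((y - 1) * exp y + 1) y :=
    ((((hasDerivAt_id y).sub_const 2).mul (hasDerivAt_exp y)).add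
      (hasDerivAt_id y)).add_const 2 |>.congr_deriv (by simp only [id_eq]; ring)
  refine monotone_of_deriv_nonneg (fun y => (hderiv y).differentiableAt) fun y => ?_
  have hexp : (1 - y) * exp y ≤ exp (-y) * exp y := by
    gcongr
    linarith [add_one_le_exp (-y)]
  rw [← exp_add, neg_add_cancel, exp_zero] at hexp
  rw [(hderiv y).deriv]
  linarith

theorem one_sub_div_three_mul_exp_sub_le (y : ℝ) :
    (1 - y / 3) * (exp y - 1 - y) ≤ y ^ 2 / 2 := by
  let f : ℝ → ℝ := fun y => y ^ 2 / 2 - (1 - y / 3) * (exp y - 1 - y)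
  have hderiv (y : ℝ) : HasDerivAt f (((y - 2) * exp y + y + 2) / 3) y :=
    (((hasDerivAt_id y).pow 2).div_const 2).sub
      ((((hasDerivAt_id y).div_const 3).const_sub 1).mul
        (((hasDerivAt_exp y).sub_const 1).sub (hasDerivAt_id y)))
      |>.congr_deriv (by simp only [Pi.sub_apply, id_eq]; ring)
  have hconvex : ConvexOn ℝ Set.univ f := by
    refine Monotone.convexOn_univ_of_deriv (fun y => (hderiv y).differentiableAt) fun y z hyz => ?_
    rw [(hderiv y).deriv, (hderiv z).deriv]
    exact div_le_div_of_nonneg_right (monotone_sub_two_mul_exp hyz) zero_le_three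
  have hmin : IsMinOn f Set.univ 0 :=
    hconvex.isMinOn_of_rightDeriv_eq_zero (by simp)
      (((hderiv 0).hasDerivWithinAt.derivWithin (uniqueDiffWithinAt_Ioi 0)).trans (by simp))
  have hy : f 0 ≤ f y := hmin (Set.mem_univ y)
  simpa [f] using hy

theorem exp_le_one_add_add_sq_div {y c : ℝ} (hyc : y ≤ c) (hc : c < 3) :
    exp y ≤ 1 + y + y ^ 2 / (2 * (1 - c / 3)) := by
  have hpos : 0 < 1 - c / 3 := by linarith
  have hmul : (1 - c / 3) * (exp y - 1 - y) ≤ y ^ 2 / 2 :=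
    (mul_le_mul_of_nonneg_right (by linarith) (by linarith [add_one_le_exp y])).trans
      (one_sub_div_three_mul_exp_sub_le y)
  have hdiv : exp y - 1 - y ≤ y ^ 2 / (2 * (1 - c / 3)) := by
    rw [le_div_iff₀ (by positivity)]
    linarith
  linarith

theorem sum_mul_exp_le_of_mem_stdSimplex {ι : Type*} [Fintype ι] {w U : ι → ℝ} {b s v : ℝ}
    (hw : w ∈ stdSimplex ℝ ι) (hU : ∀ i, U i ≤ b) (hs : 0 ≤ s) (hbs : s * b < 3)
    (hmean : ∑ i, w i * U i ≤ 0) (hvar : ∑ i, w i * U i ^ 2 ≤ v) :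
    ∑ i, w i * exp (s * U i) ≤ exp (s ^ 2 * v / (2 * (1 - s * b / 3))) := by
  have hpos : 0 < 1 - s * b / 3 := by linarith
  calc ∑ i, w i * exp (s * U i)
      ≤ ∑ i, w i * (1 + s * U i + (s * U i) ^ 2 / (2 * (1 - s * b / 3))) :=
        sum_le_sum fun i _ => mul_le_mul_of_nonneg_left
          (exp_le_one_add_add_sq_div (mul_le_mul_of_nonneg_left (hU i) hs) hbs) (hw.1 i)
    _ = ∑ i, w i + s * ∑ i, w i * U i
          + s ^ 2 / (2 * (1 - s * b / 3)) * ∑ i, w i * U i ^ 2 := by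
        simp only [mul_sum, ← sum_add_distrib]
        exact sum_congr rfl fun i _ => by ring
    _ ≤ 1 + 0 + s ^ 2 / (2 * (1 - s * b / 3)) * v := by
        gcongr
        · exact hw.2.le
        · exact mul_nonpos_of_nonneg_of_nonpos hs hmean
    _ = s ^ 2 * v / (2 * (1 - s * b / 3)) + 1 := by ring
    _ ≤ exp (s ^ 2 * v / (2 * (1 - s * b / 3))) := add_one_le_exp _

-- The convex conjugate of `s ↦ s² v / (2 (1 - s b / 3))` has the value `lam` at
-- `√(2 v lam) + b lam / 3`; the witness is the point where it is attained.
theorem exists_bernstein_exponent {b v lam : ℝ} (hb : 0 ≤ b) (hv : 0 < v) (hlam : 0 ≤ lam) :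
    ∃ s, 0 ≤ s ∧ s * b < 3 ∧
      s ^ 2 * v / (2 * (1 - s * b / 3)) - s * (√(2 * v) * √lam + b / 3 * lam) = -lam := by
  obtain ⟨u, hu, rfl⟩ : ∃ u, 0 ≤ u ∧ lam = u ^ 2 := ⟨√lam, by positivity, by simp [hlam]⟩
  obtain ⟨d, hd, hdv⟩ : ∃ d, 0 < d ∧ 2 * v = d ^ 2 :=
    ⟨√(2 * v), by positivity, by rw [sq_sqrt]; positivity⟩
  obtain rfl : v = d ^ 2 / 2 := by linarith
  rw [hdv, sqrt_sq hd.le, sqrt_sq hu]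
  have hden : 0 < 1 + b / 3 * (2 * u / d) := by positivity
  have hslack : 1 - 2 * u / d / (1 + b / 3 * (2 * u / d)) * b / 3
      = 1 / (1 + b / 3 * (2 * u / d)) := by field_simp; ring
  refine ⟨2 * u / d / (1 + b / 3 * (2 * u / d)), by positivity, ?_, ?_⟩
  · linarith [one_div_pos.2 hden]
  · have : d * 3 + b * (2 * u) ≠ 0 := by positivity
    rw [hslack]
    field_simp
    ring

/-! ### Adapted processes -/

section Adapted

variable {α : Type*}

/-- Real processes of `n` rounds with values in `α` whose value in each round depends only on the
letters up to that round; both conditional mass functions and scores are of this kind. -/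
abbrev Adapted (n : ℕ) (α : Type*) : Type _ := (i : Fin n) → (Fin i → α) → α → ℝ

/-- The product of an adapted process along the sequence `u`; for conditional mass functions this
is the probability of `u`. -/
def pathProd {n : ℕ} (w : Adapted n α) (u : Fin n → α) : ℝ := ∏ i, w i (past i u) (u i)

/-- The total of an adapted process along the sequence `u`. -/
def pathSum {n : ℕ} (U : Adapted n α) (u : Fin n → α) : ℝ := ∑ i, U i (past i u) (u i)

theorem pathProd_nonneg {n : ℕ} {w : Adapted n α} (hw : ∀ i v c, 0 ≤ w i v c) (u : Fin n → α) :
    0 ≤ pathProd w u :=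
  prod_nonneg fun i _ => hw i _ _

theorem past_castSucc_snoc {n : ℕ} (v : Fin n → α) (c : α) (i : Fin n) :
    past i.castSucc (Fin.snoc v c : Fin (n + 1) → α) = past i v :=
  funext fun j => Fin.snoc_castSucc (α := fun _ => α) c v (j.castLE i.isLt.le)

theorem past_last_snoc {n : ℕ} (v : Fin n → α) (c : α) :
    past (Fin.last n) (Fin.snoc v c : Fin (n + 1) → α) = v :=
  funext fun j => Fin.snoc_castSucc (α := fun _ => α) c v j

theorem pathProd_snoc {n : ℕ} (w : Adapted (n + 1) α) (v : Fin n → α) (c : α) :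
    pathProd w (Fin.snoc v c : Fin (n + 1) → α)
      = pathProd (fun i => w i.castSucc) v * w (Fin.last n) v c := by
  simp only [pathProd, Fin.prod_univ_castSucc, past_last_snoc, Fin.snoc_last, past_castSucc_snoc,
    Fin.snoc_castSucc]

variable [Fintype α]

theorem sum_pathProd_succ {n : ℕ} (w : Adapted (n + 1) α) :
    ∑ u, pathProd w u
      = ∑ v, pathProd (fun i => w i.castSucc) v * ∑ c, w (Fin.last n) v c := by
  rw [← (Fin.snocEquiv fun _ => α).sum_comp, Fintype.sum_prod_type, sum_comm]
  refine sum_congr rfl fun v _ => ?_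
  rw [mul_sum]
  exact sum_congr rfl fun c _ => pathProd_snoc w v c

theorem sum_pathProd_le_pow {n : ℕ} {w : Adapted n α} {C : ℝ} (hw : ∀ i v c, 0 ≤ w i v c)
    (hC : ∀ i v, ∑ c, w i v c ≤ C) : ∑ u, pathProd w u ≤ C ^ n := by
  induction n with
  | zero => simp [pathProd]
  | succ n ih =>
    have hC0 : 0 ≤ C := (sum_nonneg fun c _ => hw 0 _ c).trans (hC 0 fun j => j.elim0)
    calc ∑ u, pathProd w u
        ≤ ∑ v, pathProd (fun i => w i.castSucc) v * C := by
          rw [sum_pathProd_succ]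
          gcongr with v
          · exact pathProd_nonneg (fun i => hw i.castSucc) v
          · exact hC (Fin.last n) v
      _ ≤ C ^ n * C := by
          rw [← sum_mul]
          gcongr
          exact ih (fun i => hw i.castSucc) fun i => hC i.castSucc
      _ = C ^ (n + 1) := (pow_succ _ _).symm

theorem sum_pathProd_eq_one {n : ℕ} {w : Adapted n α} (hw : ∀ i v, ∑ c, w i v c = 1) :
    ∑ u, pathProd w u = 1 := by
  induction n with
  | zero => simp [pathProd]
  | succ n ih =>
    rw [sum_pathProd_succ, ← ih fun i => hw i.castSucc]
    exact sum_congr rfl fun v _ => by rw [hw (Fin.last n) v, mul_one]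

theorem sum_filter_lt_le_exp_mul {ι : Type*} [Fintype ι] {m : ι → ℝ} (hm : ∀ i, 0 ≤ m i)
    (S : ι → ℝ) {s : ℝ} (hs : 0 ≤ s) (c : ℝ) :
    ∑ i with c < S i, m i ≤ exp (-(s * c)) * ∑ i, m i * exp (s * S i) := by
  calc ∑ i with c < S i, m i
      ≤ ∑ i with c < S i, m i * exp (s * (S i - c)) := by
        refine sum_le_sum fun i hi => le_mul_of_one_le_right (hm i) (one_le_exp ?_)
        exact mul_nonneg hs (sub_nonneg.2 (mem_filter.1 hi).2.le)
    _ ≤ ∑ i, m i * exp (s * (S i - c)) :=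
        sum_le_sum_of_subset_of_nonneg (filter_subset _ _) fun i _ _ =>
          mul_nonneg (hm i) (exp_pos _).le
    _ = exp (-(s * c)) * ∑ i, m i * exp (s * S i) := by
        rw [mul_sum]
        refine sum_congr rfl fun i _ => ?_
        rw [mul_left_comm, ← exp_add]
        ring_nf

theorem sum_pathProd_mul_exp_pathSum_le {n : ℕ} {w U : Adapted n α} {b s v : ℝ}
    (hw : ∀ i h, w i h ∈ stdSimplex ℝ α) (hU : ∀ i h c, U i h c ≤ b) (hs : 0 ≤ s)
    (hbs : s * b < 3) (hmean : ∀ i h, ∑ c, w i h c * U i h c ≤ 0)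
    (hvar : ∀ i h, ∑ c, w i h c * U i h c ^ 2 ≤ v) :
    ∑ u, pathProd w u * exp (s * pathSum U u)
      ≤ exp (s ^ 2 * v / (2 * (1 - s * b / 3))) ^ n := by
  have hprod (u : Fin n → α) : pathProd w u * exp (s * pathSum U u)
      = pathProd (fun i h c => w i h c * exp (s * U i h c)) u := by
    simp only [pathProd, pathSum, mul_sum, exp_sum, prod_mul_distrib]
  simp only [hprod]
  exact sum_pathProd_le_pow (fun i h c => mul_nonneg ((hw i h).1 c) (exp_pos _).le)
    fun i h => sum_mul_exp_le_of_mem_stdSimplex (hw i h) (hU i h) hs hbs (hmean i h) (hvar i h)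

theorem sum_pathProd_lt_pathSum_le {n : ℕ} {w U : Adapted n α} {b v lam : ℝ} (hv : 0 < v)
    (hlam : 0 ≤ lam) (ht : 0 ≤ √(2 * v) * √lam + b / 3 * lam)
    (hw : ∀ i h, w i h ∈ stdSimplex ℝ α) (hU : ∀ i h c, U i h c ≤ b)
    (hmean : ∀ i h, ∑ c, w i h c * U i h c ≤ 0)
    (hvar : ∀ i h, ∑ c, w i h c * U i h c ^ 2 ≤ v) :
    ∑ u with n * (√(2 * v) * √lam + b / 3 * lam) < pathSum U u, pathProd w u
      ≤ exp (-(n * lam)) := by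
  set t := √(2 * v) * √lam + b / 3 * lam
  rcases lt_or_ge b 0 with hb | hb
  · have hle (u : Fin n → α) : pathSum U u ≤ n * t :=
      (sum_nonpos fun i _ => (hU i _ _).trans hb.le).trans (by positivity)
    rw [filter_false_of_mem fun u _ => (hle u).not_gt, sum_empty]
    exact (exp_pos _).le
  obtain ⟨s, hs, hbs, hexp⟩ := exists_bernstein_exponent hb hv hlam
  calc ∑ u with n * t < pathSum U u, pathProd w u
      ≤ exp (-(s * (n * t))) * ∑ u, pathProd w u * exp (s * pathSum U u) :=
        sum_filter_lt_le_exp_mul (pathProd_nonneg fun i h => (hw i h).1) _ hs _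
    _ ≤ exp (-(s * (n * t))) * exp (s ^ 2 * v / (2 * (1 - s * b / 3))) ^ n := by
        gcongr
        exact sum_pathProd_mul_exp_pathSum_le hw hU hs hbs hmean hvar
    _ = exp (-(n * lam)) := by
        rw [← exp_nat_mul, ← exp_add]
        congr 1
        linear_combination (n : ℝ) * hexp

end Adapted

/-! ### Second moments -/

theorem negMulLog_le_inv_exp_one {q : ℝ} (hq : 0 ≤ q) : negMulLog q ≤ (exp 1)⁻¹ := by
  have h : negMulLog (exp 1 * q) ≤ 1 - exp 1 * q := negMulLog_le_one_sub_self (by positivity)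
  rw [negMulLog_mul, negMulLog, log_exp] at h
  rw [← one_div, le_div_iff₀' (exp_pos 1)]
  linarith

theorem mul_log_sq_le {q : ℝ} (hq : 0 ≤ q) (hq1 : q ≤ 1) :
    q * log q ^ 2 ≤ 4 * (exp 1)⁻¹ ^ 2 := by
  calc q * log q ^ 2 = 4 * negMulLog (√q) ^ 2 := by
        rw [negMulLog, log_sqrt hq, mul_pow, neg_sq, sq_sqrt hq]
        ring
    _ ≤ 4 * (exp 1)⁻¹ ^ 2 := by
        have := negMulLog_nonneg (sqrt_nonneg q) (sqrt_le_one.2 hq1)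
        gcongr
        exact negMulLog_le_inv_exp_one (sqrt_nonneg q)

theorem mul_log_sq_le_of_half_le {q : ℝ} (hq : 1 / 2 ≤ q) (hq1 : q ≤ 1) :
    q * log q ^ 2 ≤ (exp 1)⁻¹ * log 2 := by
  have hq0 : 0 ≤ q := by linarith
  have hlog : -log q ≤ log 2 := by
    rw [← log_inv]
    exact log_le_log (by positivity) (inv_le_of_inv_le₀ two_pos (by rwa [← one_div]))
  calc q * log q ^ 2 = negMulLog q * -log q := by rw [negMulLog]; ring
    _ ≤ (exp 1)⁻¹ * log 2 :=
        mul_le_mul (negMulLog_le_inv_exp_one hq0) hlog (neg_nonneg.2 (log_nonpos hq0 hq1))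
          (by positivity)

theorem mul_log_sq_add_le {q : ℝ} (hq : 0 ≤ q) (hq1 : q ≤ 1) :
    q * log q ^ 2 + (1 - q) * log (1 - q) ^ 2 ≤ 8 * (exp 1)⁻¹ ^ 2 - log 2 ^ 2 / 4 := by
  wlog h : q ≤ 1 / 2 generalizing q
  · have := this (q := 1 - q) (by linarith) (by linarith) (by linarith)
    rw [sub_sub_cancel] at this
    linarith
  have hsmall := mul_log_sq_le hq hq1
  have hlarge := mul_log_sq_le_of_half_le (q := 1 - q) (by linarith) (by linarith)
  have hlog : 0 < log 2 := log_pos one_lt_two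
  have hconst : log 2 ≤ 2 * (exp 1)⁻¹ := by
    rw [← div_eq_mul_inv, le_div_iff₀ (exp_pos 1)]
    nlinarith [exp_one_lt_d9, log_two_lt_d9]
  nlinarith

theorem mul_logb_sq_add_le {q : ℝ} (hq : 0 ≤ q) (hq1 : q ≤ 1) :
    q * logb 2 q ^ 2 + (1 - q) * logb 2 (1 - q) ^ 2
      ≤ 8 / exp 1 ^ 2 * logb 2 (exp 1) ^ 2 - 1 / 4 := by
  have : 0 < log 2 := log_pos one_lt_two
  calc q * logb 2 q ^ 2 + (1 - q) * logb 2 (1 - q) ^ 2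
      = (q * log q ^ 2 + (1 - q) * log (1 - q) ^ 2) / log 2 ^ 2 := by
        simp only [logb]
        ring
    _ ≤ (8 * (exp 1)⁻¹ ^ 2 - log 2 ^ 2 / 4) / log 2 ^ 2 := by
        gcongr
        exact mul_log_sq_add_le hq hq1
    _ = 8 / exp 1 ^ 2 * logb 2 (exp 1) ^ 2 - 1 / 4 := by
        rw [logb, log_exp]
        field_simp

section SecondMoment

variable {ι : Type*} [Fintype ι] {w Y ℓ : ι → ℝ} {a b : ℝ}

theorem sum_mul_sq_le (hw : w ∈ stdSimplex ℝ ι) (ha : ∀ i, a ≤ Y i) (hb : ∀ i, Y i ≤ b) :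
    ∑ i, w i * Y i ^ 2 ≤ (a + b) * ∑ i, w i * Y i - a * b := by
  have hnonneg : 0 ≤ ∑ i, w i * ((Y i - a) * (b - Y i)) := sum_nonneg fun i _ =>
    mul_nonneg (hw.1 i) (mul_nonneg (sub_nonneg.2 (ha i)) (sub_nonneg.2 (hb i)))
  have hexpand : ∑ i, w i * ((Y i - a) * (b - Y i))
      = (a + b) * ∑ i, w i * Y i - a * b * ∑ i, w i - ∑ i, w i * Y i ^ 2 := by
    simp only [mul_sum, ← sum_sub_distrib]
    exact sum_congr rfl fun i _ => by ring
  rw [hw.2] at hexpand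
  linarith

theorem sum_mul_sq_le_max (hw : w ∈ stdSimplex ℝ ι) (ha : ∀ i, a ≤ Y i) (hb : ∀ i, Y i ≤ b)
    (hmean : ∑ i, w i * Y i ≤ 1) : ∑ i, w i * Y i ^ 2 ≤ max (a ^ 2) (a + b - a * b) := by
  have hsq := sum_mul_sq_le hw ha hb
  rcases le_total 0 (a + b) with hab | hab
  · exact le_max_of_le_right (by linarith [mul_le_mul_of_nonneg_left hmean hab])
  · have hmean' : a ≤ ∑ i, w i * Y i := by
      rw [← mul_one a, ← hw.2, mul_sum]
      exact sum_le_sum fun i _ => by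
        rw [mul_comm]
        exact mul_le_mul_of_nonneg_left (ha i) (hw.1 i)
    exact le_max_of_le_left (by linarith [mul_le_mul_of_nonpos_left hmean' hab])

theorem sum_mul_mul_le_neg (hw : ∀ i, 0 ≤ w i) (ha : ∀ i, a ≤ Y i) (ha0 : a ≤ 0)
    (hℓ : ∀ i, ℓ i ≤ 0) (hℓ1 : -1 ≤ ∑ i, w i * ℓ i) : ∑ i, w i * (Y i * ℓ i) ≤ -a := by
  calc ∑ i, w i * (Y i * ℓ i) ≤ ∑ i, w i * (a * ℓ i) :=
        sum_le_sum fun i _ =>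
          mul_le_mul_of_nonneg_left (mul_le_mul_of_nonpos_right (ha i) (hℓ i)) (hw i)
    _ = a * ∑ i, w i * ℓ i := by
        rw [mul_sum]
        exact sum_congr rfl fun i _ => mul_left_comm ..
    _ ≤ -a := by linarith [mul_le_mul_of_nonpos_left hℓ1 ha0]

theorem sum_mul_add_sq_le (hw : w ∈ stdSimplex ℝ ι) (ha : ∀ i, a ≤ Y i) (hb : ∀ i, Y i ≤ b)
    (ha0 : a ≤ 0) (hℓ : ∀ i, ℓ i ≤ 0) (hℓ1 : -1 ≤ ∑ i, w i * ℓ i)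
    (hmean : ∑ i, w i * (Y i + ℓ i) ≤ 0) :
    ∑ i, w i * (Y i + ℓ i) ^ 2
      ≤ max (a ^ 2) (a + b - a * b) - 2 * a + ∑ i, w i * ℓ i ^ 2 := by
  have hY : ∑ i, w i * Y i ≤ 1 := by
    simp only [mul_add, sum_add_distrib] at hmean
    linarith
  have hexpand : ∑ i, w i * (Y i + ℓ i) ^ 2
      = ∑ i, w i * Y i ^ 2 + 2 * ∑ i, w i * (Y i * ℓ i) + ∑ i, w i * ℓ i ^ 2 := by
    simp only [mul_sum, ← sum_add_distrib]
    exact sum_congr rfl fun i _ => by ring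
  linarith [sum_mul_sq_le_max hw ha hb hY, sum_mul_mul_le_neg hw.1 ha ha0 hℓ hℓ1]

-- The slack `1 / 4` absorbs the linear term: `s ≤ s ^ 2 + 1 / 4` for `s = a + b - 2 * d`.
theorem max_sq_add_sub_mul_sub_le {d : ℝ} (ha0 : a ≤ 0) (hab : a ≤ b) (hd : 0 ≤ d) :
    max (a ^ 2) (a + b - a * b) - 2 * a
      ≤ max ((b - d) ^ 2) ((a - d) ^ 2) + 2 * (d - a) + 1 / 4 := by
  have hA := le_max_right ((b - d) ^ 2) ((a - d) ^ 2)
  have hB := le_max_left ((b - d) ^ 2) ((a - d) ^ 2)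
  suffices h : a ^ 2 ≤ max ((b - d) ^ 2) ((a - d) ^ 2) ∧
      a + b - a * b ≤ max ((b - d) ^ 2) ((a - d) ^ 2) + 2 * d + 1 / 4 by
    linarith [max_le (h.1.trans (by linarith)) h.2]
  have hba : 0 ≤ b - a := sub_nonneg.2 hab
  refine ⟨by nlinarith, ?_⟩
  rcases le_total 0 (a - d + (b - d)) with hsum | hsum
  · nlinarith [sq_nonneg (a - d + (b - d) - 1 / 2), mul_nonneg hba hsum]
  · nlinarith [sq_nonneg (a + b), mul_nonneg hba (neg_nonneg.2 hsum)]

end SecondMoment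

/-! ### Events and their conditional probabilities -/

section Prob

variable {Ω Y : Type*} (μ : PMF Ω)

theorem prob_eq_measureReal (S : Set Ω) : prob μ S = (@PMF.toMeasure Ω ⊤ μ).real S := by
  let _ : MeasurableSpace Ω := ⊤
  rw [prob, MeasureTheory.measureReal_def, μ.toMeasure_apply_eq_toOuterMeasure]

theorem prob_nonneg (S : Set Ω) : 0 ≤ prob μ S := ENNReal.toReal_nonneg

theorem prob_mono_of_forall_ne_zero {S T : Set Ω} (h : ∀ o ∈ S, prob μ {o} ≠ 0 → o ∈ T) :
    prob μ S ≤ prob μ T := by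
  have hsupp : S ∩ μ.support ⊆ T := by
    rintro o ⟨hS, ho⟩
    refine h o hS ?_
    rw [prob, PMF.toOuterMeasure_apply_singleton]
    exact (ENNReal.toReal_pos ho (μ.apply_ne_top o)).ne'
  refine ENNReal.toReal_mono ?_ (PMF.toOuterMeasure_mono μ hsupp)
  let _ : MeasurableSpace Ω := ⊤
  rw [← μ.toMeasure_apply_eq_toOuterMeasure]
  exact MeasureTheory.measure_ne_top _ _

theorem prob_mono {S T : Set Ω} (h : S ⊆ T) : prob μ S ≤ prob μ T :=
  prob_mono_of_forall_ne_zero μ fun _ ho _ => h ho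

theorem prob_univ : prob μ Set.univ = 1 := by
  let _ : MeasurableSpace Ω := ⊤
  rw [prob_eq_measureReal, MeasureTheory.probReal_univ]

theorem prob_le_one (S : Set Ω) : prob μ S ≤ 1 :=
  (prob_mono μ (Set.subset_univ S)).trans_eq (prob_univ μ)

theorem prob_union_le (S T : Set Ω) : prob μ (S ∪ T) ≤ prob μ S + prob μ T := by
  let _ : MeasurableSpace Ω := ⊤
  simp only [prob_eq_measureReal]
  exact MeasureTheory.measureReal_union_le S T

theorem prob_compl (S : Set Ω) : prob μ Sᶜ = 1 - prob μ S := by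
  let _ : MeasurableSpace Ω := ⊤
  simp only [prob_eq_measureReal]
  exact MeasureTheory.probReal_compl_eq_one_sub trivial

theorem prob_le_prob_inter_add_prob_compl (S T : Set Ω) :
    prob μ S ≤ prob μ (S ∩ T) + prob μ Tᶜ := by
  refine (prob_mono μ fun o ho => ?_).trans (prob_union_le μ _ _)
  exact (em (o ∈ T)).imp (fun h => ⟨ho, h⟩) id

theorem condProb_nonneg (S T : Set Ω) : 0 ≤ condProb μ S T :=
  div_nonneg (prob_nonneg μ _) (prob_nonneg μ _)

theorem prob_mul_condProb (S : Set Ω) {T : Set Ω} (h : prob μ T ≠ 0) :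
    prob μ T * condProb μ S T = prob μ (S ∩ T) :=
  mul_div_cancel₀ _ h

theorem hasSum_prob_inter_preimage (f : Ω → Y) (S : Set Ω) :
    HasSum (fun y => prob μ (S ∩ f ⁻¹' {y})) (prob μ S) := by
  have h : ∑' y, μ.toOuterMeasure (S ∩ f ⁻¹' {y}) = μ.toOuterMeasure S := by
    simp only [PMF.toOuterMeasure_apply]
    rw [← ENNReal.tsum_fiberwise _ f]
    refine tsum_congr fun y => ?_
    rw [_root_.tsum_subtype, Set.indicator_indicator, Set.inter_comm]
  have hS : μ.toOuterMeasure S ≠ ⊤ := by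
    let _ : MeasurableSpace Ω := ⊤
    rw [← μ.toMeasure_apply_eq_toOuterMeasure]
    exact MeasureTheory.measure_ne_top _ _
  have hsum := ENNReal.hasSum_toReal (h.trans_ne hS)
  rwa [← ENNReal.tsum_toReal_eq (ENNReal.ne_top_of_tsum_ne_top (h.trans_ne hS)), h] at hsum

theorem sum_prob_inter_preimage [Fintype Y] (f : Ω → Y) (S : Set Ω) :
    ∑ y, prob μ (S ∩ f ⁻¹' {y}) = prob μ S :=
  (hasSum_fintype _).unique (hasSum_prob_inter_preimage μ f S)

theorem prob_inter_eq_sum_filter [Fintype Y] (f : Ω → Y) (S : Set Ω) (p : Y → Prop)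
    [DecidablePred p] :
    prob μ (S ∩ {o | p (f o)}) = ∑ y with p y, prob μ (S ∩ f ⁻¹' {y}) := by
  rw [← sum_prob_inter_preimage μ f, sum_filter]
  refine sum_congr rfl fun y _ => ?_
  split_ifs with hy
  · congr 1
    ext o
    constructor
    · exact fun ho => ⟨ho.1.1, ho.2⟩
    · rintro ⟨ho, rfl⟩
      exact ⟨⟨ho, hy⟩, rfl⟩
  · rw [show S ∩ {o | p (f o)} ∩ f ⁻¹' {y} = ∅ from
      Set.eq_empty_of_forall_notMem fun o ho => hy (ho.2 ▸ ho.1.2)]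
    simp [prob]

theorem prob_le_of_prob_inter_preimage_le {c : ℝ} (f : Ω → Y) {S : Set Ω}
    (h : ∀ y, prob μ (S ∩ f ⁻¹' {y}) ≤ c * prob μ (f ⁻¹' {y})) : prob μ S ≤ c := by
  have hle := hasSum_le h (hasSum_prob_inter_preimage μ f S)
    (by simpa only [Set.univ_inter] using (hasSum_prob_inter_preimage μ f Set.univ).mul_left c)
  rwa [prob_univ, mul_one] at hle

end Prob

/-! ### Total variation -/

section TotalVariation

variable {Ω Ω' : Type*}

theorem mul_TV {c : ℝ} (hc : 0 ≤ c) (f g : Ω → ℝ) :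
    c * TV f g = TV (fun z => c * f z) fun z => c * g z := by
  simp only [TV, ← mul_sub, abs_mul, abs_of_nonneg hc, tsum_mul_left]
  ring

theorem TV_comp_equiv (e : Ω' ≃ Ω) (f g : Ω → ℝ) :
    TV (fun z => f (e z)) (fun z => g (e z)) = TV f g :=
  congrArg (1 / 2 * ·) (e.tsum_eq fun z => |f z - g z|)

theorem TV_add_le [Finite Ω] (f g f' g' : Ω → ℝ) :
    TV (f + f') (g + g') ≤ TV f g + TV f' g' := by
  cases nonempty_fintype Ω
  simp only [TV, tsum_fintype, ← mul_add, ← sum_add_distrib, Pi.add_apply, add_sub_add_comm]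
  gcongr
  exact abs_add_le _ _

theorem TV_le_of_sum_eq [Fintype Ω] {f g : Ω → ℝ} (hf : ∀ z, 0 ≤ f z) (hg : ∀ z, 0 ≤ g z)
    {c : ℝ} (hfc : ∑ z, f z = c) (hgc : ∑ z, g z = c) : TV f g ≤ c := by
  have hle : ∑ z, |f z - g z| ≤ ∑ z, (f z + g z) := by
    gcongr with z
    exact abs_sub_le_iff.2 ⟨by linarith [hg z], by linarith [hf z]⟩
  rw [sum_add_distrib, hfc, hgc] at hle
  rw [TV, tsum_fintype]
  linarith

theorem TV_le_of_hasSum {D Y : Type*} [Finite D] {f g : D × Y → ℝ} {b : Y → ℝ} {c : ℝ}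
    (hb : ∀ y, TV (fun d => f (d, y)) (fun d => g (d, y)) ≤ b y) (hc : HasSum b c) :
    TV f g ≤ c := by
  cases nonempty_fintype D
  have hslice (y : Y) : ∑' d, |f (d, y) - g (d, y)| ≤ 2 * b y := by
    have := hb y
    rw [TV] at this
    linarith
  have hle : Summable fun y => ∑' d, |f (d, y) - g (d, y)| :=
    .of_nonneg_of_le (fun y => tsum_nonneg fun _ => abs_nonneg _) hslice (hc.summable.mul_left 2)
  have hs : Summable fun z : Y × D => |f (z.2, z.1) - g (z.2, z.1)| :=
    (summable_prod_of_nonneg fun _ => abs_nonneg _).2 ⟨fun _ => (hasSum_fintype _).summable, hle⟩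
  calc TV f g = 1 / 2 * ∑' y, ∑' d, |f (d, y) - g (d, y)| := by
        rw [← hs.tsum_prod]
        exact congrArg (1 / 2 * ·)
          ((Equiv.prodComm Y D).tsum_eq fun z => |f z - g z|).symm
    _ ≤ 1 / 2 * ∑' y, 2 * b y := by
        gcongr
        · exact hc.summable.mul_left 2
        · exact hslice _
    _ = c := by
        rw [tsum_mul_left, hc.tsum_eq]
        ring

end TotalVariation

/-! ### Extraction in the presence of side information -/

theorem unifMass_nonneg (α : Type*) [Fintype α] : 0 ≤ unifMass α :=
  one_div_nonneg.2 (Nat.cast_nonneg _)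

theorem card_mul_unifMass (α : Type*) [Fintype α] [Nonempty α] :
    (Fintype.card α : ℝ) * unifMass α = 1 :=
  mul_one_div_cancel (Nat.cast_ne_zero.2 Fintype.card_ne_zero)

section Extractor

variable {Ω : Type*} {n l m : ℕ} (Ext : Bits n → Bits l → Bits m)

theorem prob_withSeed_and_eq (μ : PMF Ω) (S : Set Ω) (s : Bits l) :
    prob (withSeed μ l) {q | q.1 ∈ S ∧ q.2 = s} = prob μ S * unifMass (Bits l) := by
  classical
  have hseed (o : Ω) :
      ((PMF.uniformOfFintype (Bits l)).map fun s' => (o, s')).toOuterMeasure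
        {q | q.1 ∈ S ∧ q.2 = s} = if o ∈ S then (Fintype.card (Bits l) : ENNReal)⁻¹ else 0 := by
    rw [PMF.toOuterMeasure_map_apply]
    split_ifs with h
    · rw [show (fun s' => (o, s')) ⁻¹' {q | q.1 ∈ S ∧ q.2 = s} = {s} by ext; simp [h],
        PMF.toOuterMeasure_apply_singleton, PMF.uniformOfFintype_apply]
    · simp [h]
  rw [prob, withSeed, PMF.toOuterMeasure_bind_apply, prob, PMF.toOuterMeasure_apply, unifMass,
    one_div, ← ENNReal.toReal_natCast, ← ENNReal.toReal_inv, ← ENNReal.toReal_mul,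
    ← ENNReal.tsum_mul_right]
  simp only [hseed, Set.indicator_apply, mul_ite, ite_mul, mul_zero, zero_mul]

theorem prob_withSeed_fst (μ : PMF Ω) (S : Set Ω) :
    prob (withSeed μ l) {q | q.1 ∈ S} = prob μ S := by
  have h (s : Bits l) : prob (withSeed μ l) ({q | q.1 ∈ S} ∩ Prod.snd ⁻¹' {s})
      = prob μ S * unifMass (Bits l) := prob_withSeed_and_eq μ S s
  rw [← sum_prob_inter_preimage _ (Prod.snd : Ω × Bits l → Bits l), sum_congr rfl fun s _ => h s,
    sum_const, card_univ, nsmul_eq_mul, mul_left_comm, card_mul_unifMass, mul_one]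

/-- The mass function of the pair (extractor output, seed) when the source has the weights `w`,
which need not have total mass one, and the seed is uniform and independent of it. -/
noncomputable def extractedMass (w : Bits n → ℝ) (z : Bits m × Bits l) : ℝ :=
  (∑ a with Ext a z.2 = z.1, w a) * unifMass (Bits l)

/-- The distance of the pair (extractor output, seed) from the uniform weights of the same total
mass, when the source has the weights `w`. -/
noncomputable def extDist (w : Bits n → ℝ) : ℝ :=
  TV (extractedMass Ext w) fun _ => unifMass (Bits m × Bits l) * ∑ a, w a

theorem prob_withSeed_extract (μ : PMF Ω) (f : Ω → Bits n) (S : Set Ω) (z : Bits m × Bits l) :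
    prob (withSeed μ l) {q | Ext (f q.1) q.2 = z.1 ∧ q.2 = z.2 ∧ q.1 ∈ S}
      = extractedMass Ext (fun a => prob μ (S ∩ f ⁻¹' {a})) z := by
  have hevent : {q : Ω × Bits l | Ext (f q.1) q.2 = z.1 ∧ q.2 = z.2 ∧ q.1 ∈ S}
      = {q | q.1 ∈ S ∩ {o | Ext (f o) z.2 = z.1} ∧ q.2 = z.2} := by
    ext ⟨o, s⟩
    simp only [Set.mem_ofPred_eq, Set.mem_inter_iff]
    constructor
    · rintro ⟨h, rfl, ho⟩
      exact ⟨⟨ho, h⟩, rfl⟩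
    · rintro ⟨⟨ho, h⟩, rfl⟩
      exact ⟨h, rfl, ho⟩
  rw [hevent, prob_withSeed_and_eq, extractedMass,
    prob_inter_eq_sum_filter μ f S fun a => Ext a z.2 = z.1]

theorem sum_extractedMass (w : Bits n → ℝ) : ∑ z, extractedMass Ext w z = ∑ a, w a := by
  simp only [extractedMass, ← sum_mul, Fintype.sum_prod_type_right]
  simp only [sum_fiberwise, sum_const, card_univ, nsmul_eq_mul]
  rw [mul_right_comm, card_mul_unifMass, one_mul]

theorem extDist_add_le (v w : Bits n → ℝ) :
    extDist Ext (v + w) ≤ extDist Ext v + extDist Ext w := by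
  refine Eq.trans_le ?_ (TV_add_le _ _ _ _)
  simp only [extDist]
  congr 1 <;> funext z <;> simp only [extractedMass, Pi.add_apply, sum_add_distrib] <;> ring

theorem mul_extDist {c : ℝ} (hc : 0 ≤ c) (w : Bits n → ℝ) :
    c * extDist Ext w = extDist Ext fun a => c * w a := by
  rw [extDist, mul_TV hc, extDist]
  congr 1 <;> funext z <;> simp only [extractedMass, ← mul_sum, mul_assoc, mul_left_comm c]

theorem extDist_le_sum {w : Bits n → ℝ} (hw : ∀ a, 0 ≤ w a) : extDist Ext w ≤ ∑ a, w a := by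
  have hsum : 0 ≤ ∑ a, w a := sum_nonneg fun a _ => hw a
  refine TV_le_of_sum_eq
    (fun z => mul_nonneg (sum_nonneg fun a _ => hw a) (unifMass_nonneg _))
    (fun _ => mul_nonneg (unifMass_nonneg _) hsum) (sum_extractedMass Ext w) ?_
  rw [sum_const, card_univ, nsmul_eq_mul, ← mul_assoc, card_mul_unifMass, one_mul]

end Extractor

namespace IsStrongExtractor

variable {Ω Y : Type*} {n l m : ℕ} {Ext : Bits n → Bits l → Bits m} {k ε δ : ℝ}

theorem extDist_prob_le (hExt : IsStrongExtractor Ext k ε) (ν : PMF (Bits n))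
    (hk : ∀ a, prob ν {a} ≤ (2 : ℝ) ^ (-k)) : extDist Ext (fun a => prob ν {a}) ≤ ε := by
  have h := hExt ν hk
  have hmass (z : Bits m × Bits l) :
      prob (withSeed ν l) {q | Ext q.1 q.2 = z.1 ∧ q.2 = z.2}
        = extractedMass Ext (fun a => prob ν {a}) z := by
    simpa using prob_withSeed_extract Ext ν id Set.univ z
  have hsum : ∑ a, prob ν {a} = 1 := by
    simpa [prob_univ] using sum_prob_inter_preimage ν id Set.univ
  simpa only [hmass, extDist, hsum, mul_one] using h

theorem extDist_le (hExt : IsStrongExtractor Ext k ε) {w : Bits n → ℝ} (hw : ∀ a, 0 ≤ w a)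
    (hk : ∀ a, w a ≤ (2 : ℝ) ^ (-k) * ∑ a', w a') : extDist Ext w ≤ ε * ∑ a, w a := by
  rcases (sum_nonneg fun a _ => hw a).eq_or_lt with hzero | hpos
  · rw [← hzero, mul_zero]
    exact (extDist_le_sum Ext hw).trans_eq hzero.symm
  set N := ∑ a, w a with hN
  have hnorm (a : Bits n) : 0 ≤ N⁻¹ * w a := mul_nonneg (inv_nonneg.2 hpos.le) (hw a)
  let ν : PMF (Bits n) := PMF.ofFintype (fun a => ENNReal.ofReal (N⁻¹ * w a)) <| by
    rw [← ENNReal.ofReal_sum_of_nonneg fun a _ => hnorm a, ← mul_sum, ← hN,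
      inv_mul_cancel₀ hpos.ne', ENNReal.ofReal_one]
  have hν (a : Bits n) : prob ν {a} = N⁻¹ * w a := by
    rw [prob, PMF.toOuterMeasure_apply_singleton, PMF.ofFintype_apply,
      ENNReal.toReal_ofReal (hnorm a)]
  have h := hExt.extDist_prob_le ν fun a => by
    rw [hν, inv_mul_le_iff₀ hpos, mul_comm]
    exact hk a
  simp only [hν] at h
  rwa [← mul_extDist Ext (inv_nonneg.2 hpos.le), inv_mul_le_iff₀ hpos, mul_comm] at h

-- If `v` has mass at least `δ * c`, then `v` is a legitimate source for the extractor; otherwise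
-- the trivial bound by the total mass suffices.
theorem extDist_le_of_le (hExt : IsStrongExtractor Ext k ε) (hε : 0 ≤ ε) (hδ : 0 ≤ δ) {c : ℝ}
    (hc : 0 ≤ c) {v w : Bits n → ℝ} (hv : ∀ a, 0 ≤ v a) (hvw : v ≤ w)
    (hk : ∀ a, v a ≤ (2 : ℝ) ^ (-k) * δ * c) :
    extDist Ext w ≤ ε * ∑ a, w a + (∑ a, w a - ∑ a, v a) + δ * c := by
  have hsum : ∑ a, v a ≤ ∑ a, w a := sum_le_sum fun a _ => hvw a
  rcases le_total (δ * c) (∑ a, v a) with hlarge | hsmall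
  · have hsource := hExt.extDist_le hv fun a => (hk a).trans (by rw [mul_assoc]; gcongr)
    have hrest : extDist Ext (w - v) ≤ ∑ a, w a - ∑ a, v a := by
      rw [← sum_sub_distrib]
      exact extDist_le_sum Ext fun a => sub_nonneg.2 (hvw a)
    calc extDist Ext w = extDist Ext (v + (w - v)) := by rw [add_sub_cancel]
      _ ≤ extDist Ext v + extDist Ext (w - v) := extDist_add_le Ext _ _
      _ ≤ ε * ∑ a, v a + (∑ a, w a - ∑ a, v a) := add_le_add hsource hrest
      _ ≤ ε * ∑ a, w a + (∑ a, w a - ∑ a, v a) := by gcongr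
      _ ≤ _ := le_add_of_nonneg_right (mul_nonneg hδ hc)
  · have htriv := extDist_le_sum Ext fun a => (hv a).trans (hvw a)
    have hw := mul_nonneg hε (sum_nonneg fun a (_ : a ∈ univ) => (hv a).trans (hvw a))
    linarith

theorem TV_withSeed_le (hExt : IsStrongExtractor Ext k ε) (hε : 0 ≤ ε) (hδ : 0 ≤ δ) (μ : PMF Ω)
    (f : Ω → Bits n) (g : Ω → Y) {S G : Set Ω}
    (hk : ∀ a y, prob μ (S ∩ G ∩ g ⁻¹' {y} ∩ f ⁻¹' {a})
      ≤ (2 : ℝ) ^ (-k) * δ * prob μ (g ⁻¹' {y})) :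
    TV (fun z : (Bits m × Bits l) × Y => prob (withSeed μ l)
          {q | Ext (f q.1) q.2 = z.1.1 ∧ q.2 = z.1.2 ∧ q.1 ∈ S ∩ g ⁻¹' {z.2}})
        (fun z => unifMass (Bits m × Bits l) * prob μ (S ∩ g ⁻¹' {z.2}))
      ≤ ε * prob μ S + prob μ Gᶜ + δ := by
  have hslice (y : Y) := hExt.extDist_le_of_le hε hδ (prob_nonneg μ (g ⁻¹' {y}))
    (v := fun a => prob μ (S ∩ G ∩ g ⁻¹' {y} ∩ f ⁻¹' {a}))
    (w := fun a => prob μ (S ∩ g ⁻¹' {y} ∩ f ⁻¹' {a})) (fun _ => prob_nonneg μ _)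
    (fun _ => prob_mono μ (by gcongr; exact Set.inter_subset_left)) (hk · y)
  simp only [extDist, sum_prob_inter_preimage] at hslice
  have hsum : HasSum (fun y => ε * prob μ (S ∩ g ⁻¹' {y})
      + (prob μ (S ∩ g ⁻¹' {y}) - prob μ (S ∩ G ∩ g ⁻¹' {y})) + δ * prob μ (g ⁻¹' {y}))
      (ε * prob μ S + (prob μ S - prob μ (S ∩ G)) + δ) := by
    have hside := hasSum_prob_inter_preimage μ g Set.univ
    simp only [Set.univ_inter, prob_univ] at hside
    have hS := hasSum_prob_inter_preimage μ g S
    simpa only [mul_one] using ((hS.mul_left ε).add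
      (hS.sub (hasSum_prob_inter_preimage μ g (S ∩ G)))).add (hside.mul_left δ)
  simp only [prob_withSeed_extract]
  refine (TV_le_of_hasSum hslice hsum).trans ?_
  linarith [prob_le_prob_inter_add_prob_compl μ S G]

end IsStrongExtractor

/-! ### Positivity of the energy -/

theorem vacuum_mem_Q : ((1, 0) : (Fin 2 → ℝ) × (Fin 2 → ℝ)) ∈ Q := by
  refine subset_convexHull ℝ _ ⟨ℂ, inferInstance, inferInstance, inferInstance, ⟨?_⟩⟩
  exact
    { ι := Unit
      b := (OrthonormalBasis.singleton Unit ℂ).toHilbertBasis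
      e := 0
      vac := ()
      ρ := 1
      M := 1
      energy_vac := rfl
      energy_gap := fun j hj => (hj rfl).elim
      state_pos := fun _ => ContinuousLinearMap.isPositive_one
      state_trace := fun x => by
        simp
      neg_one_le_M := ContinuousLinearMap.isPositive_one.add ContinuousLinearMap.isPositive_one
      M_le_one := by rw [sub_self]; exact ContinuousLinearMap.isPositive_zero
      corr := fun x => by
        simp
      energy_summable := fun x => (hasSum_fintype _).summable
      energy_le := fun x => by simp }

theorem energy_nonneg_of_mem_Q {B : (Fin 2 → ℝ) × (Fin 2 → ℝ)} (hB : B ∈ Q) : 0 ≤ B.2 := by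
  have hconv : Convex ℝ {B : (Fin 2 → ℝ) × (Fin 2 → ℝ) | 0 ≤ B.2} :=
    (convex_Ici (𝕜 := ℝ) (0 : Fin 2 → ℝ)).is_linear_preimage
      (f := fun B : (Fin 2 → ℝ) × (Fin 2 → ℝ) => B.2) ⟨fun _ _ => rfl, fun _ _ => rfl⟩
  refine convexHull_min ?_ hconv hB
  rintro B ⟨K, _, _, _, ⟨R⟩⟩ x
  refine le_trans (tsum_nonneg fun j => mul_nonneg ?_ ?_) (R.energy_le x)
  · by_cases h : j = R.vac
    · rw [h, R.energy_vac]
    · exact zero_le_one.trans (R.energy_gap j h)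
  · exact (Complex.le_def.1 ((R.state_pos x).inner_nonneg_right (R.b j))).1

/-! ### A single round -/

/-- The probability of the output `a` for the correlation `e`. -/
noncomputable def outProb (e : ℝ) (a : Bool) : ℝ := (1 + sgn a * e) / 2

theorem sum_outProb (e : ℝ) : ∑ a, outProb e a = 1 := by
  simp only [outProb, sgn, Fintype.sum_bool, if_true, Bool.false_eq_true, if_false]
  ring

theorem outProb_false (e : ℝ) : outProb e false = 1 - outProb e true :=
  eq_sub_of_add_eq' ((Fintype.sum_bool _).symm.trans (sum_outProb e))

theorem outProb_nonneg {e : ℝ} (he : |e| ≤ 1) (a : Bool) : 0 ≤ outProb e a := by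
  have := abs_le.1 he
  cases a <;> simp only [outProb, sgn, if_true, Bool.false_eq_true, if_false] <;> linarith

theorem outProb_le_one {e : ℝ} (he : |e| ≤ 1) (a : Bool) : outProb e a ≤ 1 :=
  (single_le_sum (fun a' _ => outProb_nonneg he a') (mem_univ a)).trans_eq (sum_outProb e)

/-- The joint probability of the output and the input in a round with input distribution `p` and
correlations `e`. -/
noncomputable def roundMass (p e : Fin 2 → ℝ) (z : Bool × Fin 2) : ℝ := p z.2 * outProb (e z.2) z.1

theorem sum_roundMass_mul (p e : Fin 2 → ℝ) (f : Bool × Fin 2 → ℝ) :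
    ∑ z, roundMass p e z * f z = ∑ x, p x * ∑ a, outProb (e x) a * f (a, x) := by
  simp only [Fintype.sum_prod_type_right, roundMass, mul_assoc, ← mul_sum]

theorem roundMass_mem_stdSimplex {p e : Fin 2 → ℝ} (hp : p ∈ stdSimplex ℝ (Fin 2))
    (he : ∀ x, |e x| ≤ 1) : roundMass p e ∈ stdSimplex ℝ (Bool × Fin 2) := by
  refine ⟨fun z => mul_nonneg (hp.1 _) (outProb_nonneg (he _) _), ?_⟩
  simpa only [mul_one, sum_outProb, hp.2] using sum_roundMass_mul p e fun _ => 1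

theorem H_eq_neg_sum (p E : Fin 2 → ℝ) :
    H p E = -∑ z, roundMass p E z * logb 2 (outProb (E z.2) z.1) := by
  rw [H, Fintype.sum_prod_type]
  rfl

theorem H_le_one {p : Fin 2 → ℝ} (hp : p ∈ stdSimplex ℝ (Fin 2)) (E : Fin 2 → ℝ) :
    H p E ≤ 1 := by
  have hround (x : Fin 2) : -1 ≤ ∑ a, outProb (E x) a * logb 2 (outProb (E x) a) := by
    have hent : binEntropy (outProb (E x) true) / log 2 ≤ 1 :=
      (div_le_one (log_pos one_lt_two)).2 binEntropy_le_log_two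
    have heq : ∑ a, outProb (E x) a * logb 2 (outProb (E x) a)
        = -(binEntropy (outProb (E x) true) / log 2) := by
      rw [binEntropy, log_inv, log_inv, Fintype.sum_bool, outProb_false, logb, logb]
      ring
    linarith
  rw [H_eq_neg_sum, sum_roundMass_mul, neg_le, ← hp.2, ← sum_neg_distrib]
  exact sum_le_sum fun x _ => by linarith [mul_le_mul_of_nonneg_left (hround x) (hp.1 x)]

theorem sum_roundMass_mul_logb_sq_le {p e : Fin 2 → ℝ} (hp : p ∈ stdSimplex ℝ (Fin 2))
    (he : ∀ x, |e x| ≤ 1) :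
    ∑ z, roundMass p e z * logb 2 (outProb (e z.2) z.1) ^ 2
      ≤ 8 / exp 1 ^ 2 * logb 2 (exp 1) ^ 2 - 1 / 4 := by
  set c : ℝ := 8 / exp 1 ^ 2 * logb 2 (exp 1) ^ 2 - 1 / 4
  have hround (x : Fin 2) : ∑ a, outProb (e x) a * logb 2 (outProb (e x) a) ^ 2 ≤ c := by
    rw [Fintype.sum_bool, outProb_false]
    exact mul_logb_sq_add_le (outProb_nonneg (he x) true) (outProb_le_one (he x) true)
  calc _ = ∑ x, p x * ∑ a, outProb (e x) a * logb 2 (outProb (e x) a) ^ 2 :=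
        sum_roundMass_mul p e _
    _ ≤ ∑ x, p x * c :=
        sum_le_sum fun x _ => mul_le_mul_of_nonneg_left (hround x) (hp.1 x)
    _ = c := by rw [← sum_mul, hp.2, one_mul]

namespace Args

variable {P : Args} {e w : Fin 2 → ℝ}

/-- The estimate of a round with correlations `e` and energies `w`, plus the logarithm of the
probability of its output: summed over the rounds, this compares the value of the test with the
conditional min-entropy of the outputs. -/
noncomputable def score (P : Args) (e w : Fin 2 → ℝ) (z : Bool × Fin 2) : ℝ :=
  P.ξ z.1 z.2 + ∑ x, P.γ x * w x + logb 2 (outProb (e z.2) z.1)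

theorem ξ_le_ξmax (a : Bool) (x : Fin 2) : P.ξ a x ≤ P.ξmax :=
  le_ciSup (f := fun z : Bool × Fin 2 => P.ξ z.1 z.2) (Set.finite_range _).bddAbove (a, x)

theorem ξmin_le_ξ (a : Bool) (x : Fin 2) : P.ξmin ≤ P.ξ a x :=
  ciInf_le (f := fun z : Bool × Fin 2 => P.ξ z.1 z.2) (Set.finite_range _).bddBelow (a, x)

theorem V_pos : 0 < P.V := by
  have hlog : 0 < logb 2 (exp 1) := logb_pos one_lt_two (one_lt_exp_iff.2 one_pos)
  rw [V]
  positivity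

namespace Valid

theorem p_mem_stdSimplex (hP : P.Valid) : P.p ∈ stdSimplex ℝ (Fin 2) :=
  ⟨fun x => (hP.p_pos x).le, hP.p_sum⟩

theorem sum_roundMass_mul_ξ (hP : P.Valid) (e : Fin 2 → ℝ) :
    ∑ z, roundMass P.p e z * P.ξ z.1 z.2 = ∑ x, P.α x + ∑ x, P.β x * e x := by
  rw [sum_roundMass_mul, ← sum_add_distrib]
  refine sum_congr rfl fun x _ => ?_
  have := (hP.p_pos x).ne'
  simp only [outProb, sgn, ξ, Fintype.sum_bool, if_true, Bool.false_eq_true, if_false]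
  field_simp
  ring

-- The vacuum has zero entropy, so the mean of `ξ` there is nonpositive.
theorem ξmin_nonpos (hP : P.Valid) : P.ξmin ≤ 0 := by
  have hH : H P.p 1 = 0 := by simp [H, sgn]
  have hvac := hP.tradeoff.2 (1, 0) ⟨vacuum_mem_Q, hP.avg_nonneg.trans hP.avg_le_pk⟩
  simp only [hH, Pi.zero_apply, mul_zero, sum_const_zero, add_zero] at hvac
  have hmass := roundMass_mem_stdSimplex (e := 1) hP.p_mem_stdSimplex (by simp)
  calc P.ξmin = ∑ z, roundMass P.p 1 z * P.ξmin := by rw [← sum_mul, hmass.2, one_mul]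
    _ ≤ ∑ z, roundMass P.p 1 z * P.ξ z.1 z.2 :=
        sum_le_sum fun z _ => mul_le_mul_of_nonneg_left (ξmin_le_ξ _ _) (hmass.1 z)
    _ ≤ 0 := (hP.sum_roundMass_mul_ξ 1).trans_le hvac

theorem sum_γ_mul_nonpos (hP : P.Valid) (hB : (e, w) ∈ Qpk P.ωpk) : ∑ x, P.γ x * w x ≤ 0 :=
  sum_nonpos fun x _ =>
    mul_nonpos_of_nonpos_of_nonneg (hP.tradeoff.1 x) (energy_nonneg_of_mem_Q hB.1 x)

theorem γbar_le_sum_γ_mul (hP : P.Valid) (hB : (e, w) ∈ Qpk P.ωpk) :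
    P.γbar ≤ ∑ x, P.γ x * w x :=
  sum_le_sum fun x _ =>
    le_mul_of_le_one_right (hP.tradeoff.1 x) (hB.2.trans hP.pk_le_one x)

theorem score_le_ξmax (hP : P.Valid) (hB : (e, w) ∈ Qpk P.ωpk) (he : ∀ x, |e x| ≤ 1)
    (z : Bool × Fin 2) : P.score e w z ≤ P.ξmax := by
  have hlog : logb 2 (outProb (e z.2) z.1) ≤ 0 :=
    logb_nonpos one_lt_two (outProb_nonneg (he _) _) (outProb_le_one (he _) _)
  rw [score]
  linarith [ξ_le_ξmax (P := P) z.1 z.2, hP.sum_γ_mul_nonpos hB]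

theorem sum_roundMass_mul_score_nonpos (hP : P.Valid) (hB : (e, w) ∈ Qpk P.ωpk)
    (he : ∀ x, |e x| ≤ 1) : ∑ z, roundMass P.p e z * P.score e w z ≤ 0 := by
  have htradeoff := hP.tradeoff.2 _ hB
  rw [H_eq_neg_sum, ← hP.sum_roundMass_mul_ξ] at htradeoff
  simp only [score, mul_add, sum_add_distrib, ← sum_mul,
    (roundMass_mem_stdSimplex hP.p_mem_stdSimplex he).2, one_mul]
  linarith

theorem sum_roundMass_mul_score_sq_le (hP : P.Valid) (hB : (e, w) ∈ Qpk P.ωpk)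
    (he : ∀ x, |e x| ≤ 1) : ∑ z, roundMass P.p e z * P.score e w z ^ 2 ≤ P.V := by
  set g := ∑ x, P.γ x * w x with hg
  have hmass := roundMass_mem_stdSimplex hP.p_mem_stdSimplex he
  have hmean := hP.sum_roundMass_mul_score_nonpos hB he
  have hentropy : -1 ≤ ∑ z, roundMass P.p e z * logb 2 (outProb (e z.2) z.1) := by
    rw [neg_le, ← H_eq_neg_sum]
    exact H_le_one hP.p_mem_stdSimplex e
  have hmin : P.ξmin + g ≤ 0 := add_nonpos hP.ξmin_nonpos (hP.sum_γ_mul_nonpos hB)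
  have hrange : P.ξmin + g ≤ P.ξmax + g :=
    add_le_add_left ((ξmin_le_ξ true 0).trans (ξ_le_ξmax true 0)) g
  simp only [score, ← hg] at hmean ⊢
  have hmoment := sum_mul_add_sq_le hmass (fun z => add_le_add_left (ξmin_le_ξ z.1 z.2) g)
    (fun z => add_le_add_left (ξ_le_ξmax z.1 z.2) g) hmin
    (fun z => logb_nonpos one_lt_two (outProb_nonneg (he _) _) (outProb_le_one (he _) _))
    hentropy hmean
  have hmax := max_sq_add_sub_mul_sub_le hmin hrange (sub_nonneg.2 (hP.γbar_le_sum_γ_mul hB))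
  rw [show P.ξmax + g - (g - P.γbar) = P.ξmax + P.γbar by ring,
    show P.ξmin + g - (g - P.γbar) = P.ξmin + P.γbar by ring] at hmax
  have hneg := le_max_left (-(P.γbar + P.ξmin)) 0
  have hlog := sum_roundMass_mul_logb_sq_le hP.p_mem_stdSimplex he
  have hV : P.V = max ((P.ξmax + P.γbar) ^ 2) ((P.ξmin + P.γbar) ^ 2)
      + 2 * max (-(P.γbar + P.ξmin)) 0 + 8 / exp 1 ^ 2 * logb 2 (exp 1) ^ 2 := by
    rw [V, Fintype.card_bool, Nat.cast_ofNat, logb_self_eq_one one_lt_two]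
    norm_num
  linarith

end Valid

end Args

/-! ### The law of the device -/

section Device

variable {n : ℕ} {L : Type*} {p ωpk ωavg : Fin 2 → ℝ} {εω : ℝ} {μ : PMF (Run n L)}
  {E ω : RoundFun n L}

theorem prob_inter_eq_mul_pathProd {Ω α : Type*} {n : ℕ} (μ : PMF Ω) (T : Set Ω)
    (f : Ω → Fin n → α) (w : Adapted n α)
    (h : ∀ i v c, prob μ ({o | f o i = c} ∩ (T ∩ {o | past i (f o) = v}))
      = w i v c * prob μ (T ∩ {o | past i (f o) = v})) (u : Fin n → α) :
    prob μ (T ∩ {o | f o = u}) = prob μ T * pathProd w u := by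
  induction n with
  | zero =>
    rw [show {o | f o = u} = Set.univ from Set.eq_univ_of_forall fun o => Subsingleton.elim _ _,
      Set.inter_univ, pathProd, Fin.prod_univ_zero, mul_one]
  | succ n ih =>
    induction u using Fin.snocCases with
    | snoc v c =>
      have hsplit : T ∩ {o | f o = Fin.snoc v c}
          = {o | f o (Fin.last n) = c} ∩ (T ∩ {o | past (Fin.last n) (f o) = v}) := by
        ext o
        constructor
        · rintro ⟨hT, ho⟩
          refine ⟨?_, hT, ?_⟩
          · exact (congrFun ho _).trans (Fin.snoc_last ..)
          · exact (congrArg _ ho).trans (past_last_snoc v c)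
        · rintro ⟨rfl, hT, rfl⟩
          exact ⟨hT, (Fin.snoc_init_self (f o)).symm⟩
      rw [hsplit, h, pathProd_snoc, ← mul_assoc, mul_comm]
      congr 1
      exact ih (fun o => past (Fin.last n) (f o)) (fun i => w i.castSucc) (fun i => h i.castSucc) v

/-- The sequence of pairs of output and input in a run. -/
def transcript (o : Run n L) : Fin n → Bool × Fin 2 := fun i => (o.1 i, o.2.1 i)

/-- The value of a round function when the past outputs and inputs are `v` and `Λ = lam`. -/
def atPast (F : RoundFun n L) (lam : L) (i : Fin n) (v : Fin i → Bool × Fin 2) : Fin 2 → ℝ :=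
  F i (fun j => (v j).1) (fun j => (v j).2) lam

/-- The event that the average energies of the rounds are at most `ωavg`. -/
def energyEvent (ω : RoundFun n L) (ωavg : Fin 2 → ℝ) : Set (Run n L) :=
  {o | ∀ x₀, (1 / (n : ℝ)) * ∑ i, ω i (past i o.1) (past i o.2.1) o.2.2 x₀ ≤ ωavg x₀}

/-- A device whose correlations and energies are quantum behaviours for all pasts, including
those of probability zero; its law is then the product of the conditional laws of the rounds. -/
structure IsRegularDevice (μ : PMF (Run n L)) (E ω : RoundFun n L) (p ωpk ωavg : Fin 2 → ℝ)
    (εω : ℝ) : Prop where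
  mem_Qpk : ∀ i a x lam, (E i a x lam, ω i a x lam) ∈ Qpk ωpk
  abs_le_one : ∀ i a x lam x₀, |E i a x lam x₀| ≤ 1
  law : ∀ lam u, prob μ ({o | o.2.2 = lam} ∩ {o | transcript o = u})
    = prob μ {o | o.2.2 = lam} * pathProd (fun i v => roundMass p (atPast E lam i v)) u
  max_avg : 1 - εω ≤ prob μ (energyEvent ω ωavg)

/-- The round function that equals `F` at pasts of positive probability and `d` at all others,
where the device assumptions say nothing about `F`. -/
noncomputable def onSupport (μ : PMF (Run n L)) (d : Fin 2 → ℝ) (F : RoundFun n L) :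
    RoundFun n L := fun i a x lam => if prob μ (pastEvent i a x lam) = 0 then d else F i a x lam

theorem abs_le_one_of_outProb_nonneg {e : ℝ} (h : ∀ a, 0 ≤ outProb e a) : |e| ≤ 1 := by
  have htrue := h true
  have hfalse := h false
  simp only [outProb, sgn, if_true, Bool.false_eq_true, if_false] at htrue hfalse
  exact abs_le.2 ⟨by linarith, by linarith⟩

namespace DeviceAssumptions

theorem prob_input_inter_pastEvent (hμ : DeviceAssumptions μ E ω p ωpk ωavg εω) {i : Fin n}
    {a : Fin i → Bool} {x : Fin i → Fin 2} {lam : L} (h : prob μ (pastEvent i a x lam) ≠ 0)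
    (x₀ : Fin 2) : prob μ ({o | o.2.1 i = x₀} ∩ pastEvent i a x lam)
      = prob μ (pastEvent i a x lam) * p x₀ := by
  rw [← prob_mul_condProb μ _ h, hμ.input i a x lam h]

theorem abs_le_one (hμ : DeviceAssumptions μ E ω p ωpk ωavg εω) (hp : ∀ x, p x ≠ 0) {i : Fin n}
    {a : Fin i → Bool} {x : Fin i → Fin 2} {lam : L} (h : prob μ (pastEvent i a x lam) ≠ 0)
    (x₀ : Fin 2) : |E i a x lam x₀| ≤ 1 := by
  have hinput : prob μ ({o | o.2.1 i = x₀} ∩ pastEvent i a x lam) ≠ 0 := by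
    rw [hμ.prob_input_inter_pastEvent h]
    exact mul_ne_zero h (hp x₀)
  exact abs_le_one_of_outProb_nonneg fun a₀ =>
    (condProb_nonneg μ _ _).trans_eq (hμ.output i a x lam x₀ hinput a₀)

theorem prob_round (hμ : DeviceAssumptions μ E ω p ωpk ωavg εω) (hp : ∀ x, p x ≠ 0) {i : Fin n}
    {a : Fin i → Bool} {x : Fin i → Fin 2} {lam : L} (h : prob μ (pastEvent i a x lam) ≠ 0)
    (c : Bool × Fin 2) : prob μ ({o | transcript o i = c} ∩ pastEvent i a x lam)
      = roundMass p (E i a x lam) c * prob μ (pastEvent i a x lam) := by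
  have hinput := hμ.prob_input_inter_pastEvent h c.2
  have hne : prob μ ({o | o.2.1 i = c.2} ∩ pastEvent i a x lam) ≠ 0 := by
    rw [hinput]
    exact mul_ne_zero h (hp c.2)
  have hsplit : {o : Run n L | transcript o i = c} = {o | o.1 i = c.1} ∩ {o | o.2.1 i = c.2} :=
    Set.ext fun o => Prod.ext_iff
  rw [hsplit, Set.inter_assoc, ← prob_mul_condProb μ _ hne, hμ.output i a x lam c.2 hne, hinput,
    roundMass, outProb]
  ring

theorem law_onSupport (hμ : DeviceAssumptions μ E ω p ωpk ωavg εω) (hp : ∀ x, p x ≠ 0)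
    (d : Fin 2 → ℝ) (lam : L) (u : Fin n → Bool × Fin 2) :
    prob μ ({o | o.2.2 = lam} ∩ {o | transcript o = u})
      = prob μ {o | o.2.2 = lam}
        * pathProd (fun i v => roundMass p (atPast (onSupport μ d E) lam i v)) u := by
  refine prob_inter_eq_mul_pathProd μ _ _ _ (fun i v c => ?_) u
  have hpast : {o : Run n L | o.2.2 = lam} ∩ {o | past i (transcript o) = v}
      = pastEvent i (fun j => (v j).1) (fun j => (v j).2) lam := by
    ext o
    simp only [pastEvent, Set.mem_inter_iff, Set.mem_ofPred_eq, funext_iff, past, transcript,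
      Prod.ext_iff, forall_and]
    tauto
  rw [hpast, atPast, onSupport]
  split_ifs with h
  · rw [h, mul_zero]
    exact le_antisymm ((prob_mono μ Set.inter_subset_right).trans_eq h) (prob_nonneg μ _)
  · exact hμ.prob_round hp h c

theorem prob_pastEvent_ne_zero {o : Run n L} (ho : prob μ {o} ≠ 0) (i : Fin n) :
    prob μ (pastEvent i (past i o.1) (past i o.2.1) o.2.2) ≠ 0 := by
  have hmem : o ∈ pastEvent i (past i o.1) (past i o.2.1) o.2.2 := ⟨rfl, rfl, rfl⟩
  exact (((prob_nonneg μ _).lt_of_ne' ho).trans_le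
    (prob_mono μ (Set.singleton_subset_iff.2 hmem))).ne'

theorem isRegularDevice (hμ : DeviceAssumptions μ E ω p ωpk ωavg εω) (hp : ∀ x, p x ≠ 0)
    (hpk : 0 ≤ ωpk) :
    IsRegularDevice μ (onSupport μ 1 E) (onSupport μ 0 ω) p ωpk ωavg εω where
  mem_Qpk i a x lam := by
    simp only [onSupport]
    split_ifs with h
    · exact ⟨vacuum_mem_Q, hpk⟩
    · exact ⟨hμ.quantum i a x lam h, hμ.max_peak i a x lam h⟩
  abs_le_one i a x lam x₀ := by
    simp only [onSupport]
    split_ifs with h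
    · simp
    · exact hμ.abs_le_one hp h x₀
  law := hμ.law_onSupport hp 1
  max_avg := hμ.max_avg.trans <| prob_mono_of_forall_ne_zero μ fun o ho hne x₀ => by
    simpa only [onSupport, prob_pastEvent_ne_zero hne, if_false] using ho x₀

end DeviceAssumptions

end Device

/-! ### Min-entropy of the outputs -/

section MinEntropy

variable {n : ℕ} {L : Type*}

/-- The conditional probability, for correlations `E`, of the outputs of a run given its inputs
and the adversary's information. -/
noncomputable def outputProb (E : RoundFun n L) (o : Run n L) : ℝ :=
  ∏ i, outProb (E i (past i o.1) (past i o.2.1) o.2.2 (o.2.1 i)) (o.1 i)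

theorem sum_outputProb (E : RoundFun n L) (y : (Fin n → Fin 2) × L) :
    ∑ a, outputProb E (a, y) = 1 :=
  sum_pathProd_eq_one (w := fun i v c => outProb (E i v (past i y.1) y.2 (y.1 i)) c)
    fun _ _ => sum_outProb _

theorem IsRegularDevice.prob_singleton {μ : PMF (Run n L)} {E ω : RoundFun n L}
    {p ωpk ωavg : Fin 2 → ℝ} {εω : ℝ} (hμ : IsRegularDevice μ E ω p ωpk ωavg εω) (o : Run n L) :
    prob μ {o} = outputProb E o * prob μ (Prod.snd ⁻¹' {o.2}) := by
  have hmass (o : Run n L) :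
      prob μ {o} = prob μ {o' | o'.2.2 = o.2.2} * (∏ i, p (o.2.1 i)) * outputProb E o := by
    have hsplit : {o} = {o' : Run n L | o'.2.2 = o.2.2} ∩ {o' | transcript o' = transcript o} := by
      ext o'
      simp only [Set.mem_singleton_iff, Set.mem_inter_iff, Set.mem_ofPred_eq, transcript,
        Prod.ext_iff, funext_iff, forall_and]
      tauto
    rw [hsplit, hμ.law, mul_assoc, outputProb, ← prod_mul_distrib]
    rfl
  have hmarginal : prob μ (Prod.snd ⁻¹' {o.2})
      = prob μ {o' | o'.2.2 = o.2.2} * ∏ i, p (o.2.1 i) := by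
    have hfiber (a : Bits n) :
        Prod.snd ⁻¹' {o.2} ∩ Prod.fst ⁻¹' {a} = ({(a, o.2)} : Set (Run n L)) := by
      rw [Set.inter_comm, ← Set.prod_eq, Set.singleton_prod_singleton]
    rw [← sum_prob_inter_preimage μ Prod.fst]
    simp only [hfiber, hmass (_, o.2)]
    rw [← mul_sum, sum_outputProb, mul_one]
  rw [hmarginal, hmass, mul_comm]

theorem exp_neg_logb_le {ε : ℝ} (hε : 0 < ε) (hε1 : ε ≤ 1) : exp (-logb 2 (1 / ε)) ≤ ε := by
  have hlog : logb 2 ε ≤ log ε := by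
    rw [logb, div_le_iff₀ (log_pos one_lt_two)]
    exact le_mul_of_le_one_right (log_nonpos hε.le hε1) (log_two_lt_d9.le.trans (by norm_num))
  calc exp (-logb 2 (1 / ε)) = exp (logb 2 ε) := by rw [one_div, logb_inv, neg_neg]
    _ ≤ exp (log ε) := exp_le_exp.2 hlog
    _ = ε := exp_log hε

end MinEntropy

namespace Args

variable {P : Args} {L : Type*} {μ : PMF (Run P.n L)} {E ω : RoundFun P.n L}

/-- The sum of the scores of all rounds of a run with correlations `E` and energies `ω`. -/
noncomputable def totalScore (P : Args) (E ω : RoundFun P.n L) (o : Run P.n L) : ℝ :=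
  pathSum (fun i v => P.score (atPast E o.2.2 i v) (atPast ω o.2.2 i v)) (transcript o)

theorem totalScore_eq {o : Run P.n L} (h : outputProb E o ≠ 0) :
    P.totalScore E ω o = ∑ i, P.ξ (o.1 i) (o.2.1 i)
      + ∑ i, ∑ x, P.γ x * ω i (past i o.1) (past i o.2.1) o.2.2 x + logb 2 (outputProb E o) := by
  rw [outputProb, logb_prod _ _ (prod_ne_zero_iff.1 h), ← sum_add_distrib, ← sum_add_distrib]
  rfl

namespace Valid

theorem prob_lt_totalScore_le (hP : P.Valid) (ht : 0 ≤ P.t)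
    (hμ : IsRegularDevice μ E ω P.p P.ωpk P.ωavg P.εω) :
    prob μ {o | P.n * P.t < P.totalScore E ω o} ≤ P.εt := by
  classical
  rcases le_total 1 P.εt with hεt | hεt
  · exact (prob_le_one _ _).trans hεt
  have hn : (0 : ℝ) < P.n := Nat.cast_pos.2 hP.n_pos
  have hlog : 0 ≤ logb 2 (1 / P.εt) :=
    logb_nonneg one_lt_two ((one_le_div hP.εt_pos).2 hεt)
  refine prob_le_of_prob_inter_preimage_le μ (fun o => o.2.2) fun lam => ?_
  let U : Adapted P.n (Bool × Fin 2) := fun i v => P.score (atPast E lam i v) (atPast ω lam i v)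
  let w : Adapted P.n (Bool × Fin 2) := fun i v => roundMass P.p (atPast E lam i v)
  have htail : ∑ u with P.n * P.t < pathSum U u, pathProd w u ≤ P.εt := calc
    _ ≤ exp (-(P.n * (logb 2 (1 / P.εt) / P.n))) :=
      sum_pathProd_lt_pathSum_le V_pos (div_nonneg hlog hn.le) ht
        (fun _ _ => roundMass_mem_stdSimplex hP.p_mem_stdSimplex (hμ.abs_le_one _ _ _ _))
        (fun _ _ => hP.score_le_ξmax (hμ.mem_Qpk _ _ _ _) (hμ.abs_le_one _ _ _ _))
        (fun _ _ => hP.sum_roundMass_mul_score_nonpos (hμ.mem_Qpk _ _ _ _)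
          (hμ.abs_le_one _ _ _ _))
        fun _ _ => hP.sum_roundMass_mul_score_sq_le (hμ.mem_Qpk _ _ _ _) (hμ.abs_le_one _ _ _ _)
    _ ≤ P.εt := by
      rw [mul_div_cancel₀ _ hn.ne']
      exact exp_neg_logb_le hP.εt_pos hεt
  calc prob μ ({o | P.n * P.t < P.totalScore E ω o} ∩ (fun o => o.2.2) ⁻¹' {lam})
      = prob μ ({o | o.2.2 = lam} ∩ {o | P.n * P.t < pathSum U (transcript o)}) := by
        congr 1
        ext o
        constructor
        · rintro ⟨ho, rfl⟩
          exact ⟨rfl, ho⟩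
        · rintro ⟨rfl, ho⟩
          exact ⟨ho, rfl⟩
    _ = prob μ {o | o.2.2 = lam} * ∑ u with P.n * P.t < pathSum U u, pathProd w u := by
        rw [prob_inter_eq_sum_filter μ transcript _ fun u => P.n * P.t < pathSum U u, mul_sum]
        exact sum_congr rfl fun u _ => hμ.law lam u
    _ ≤ P.εt * prob μ {o | o.2.2 = lam} := by
        rw [mul_comm]
        exact mul_le_mul_of_nonneg_right htail (prob_nonneg μ _)

theorem two_rpow_neg_σh_mul_εm (hP : P.Valid) :
    (2 : ℝ) ^ (-P.σh) * P.εm = 2 ^ (-(P.n * (P.r - P.t))) := by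
  have hn : (P.n : ℝ) ≠ 0 := Nat.cast_ne_zero.2 hP.n_pos.ne'
  have hσh : -P.σh = -(P.n * (P.r - P.t)) + logb 2 (1 / P.εm) := by
    rw [σh, t]
    field_simp
    ring
  rw [hσh, rpow_add two_pos, rpow_logb two_pos (by norm_num) (one_div_pos.2 hP.εm_pos), mul_assoc,
    one_div_mul_cancel hP.εm_pos.ne', mul_one]

theorem mul_r_le_sum_ξ_add (hP : P.Valid) {o : Run P.n L} (hpass : o ∈ P.pass L)
    (henergy : o ∈ energyEvent ω P.ωavg) :
    P.n * P.r ≤ ∑ i, P.ξ (o.1 i) (o.2.1 i)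
      + ∑ i, ∑ x, P.γ x * ω i (past i o.1) (past i o.2.1) o.2.2 x := by
  have hn : (0 : ℝ) < P.n := Nat.cast_pos.2 hP.n_pos
  have hγ : P.n * ∑ x, P.γ x * P.ωavg x
      ≤ ∑ i, ∑ x, P.γ x * ω i (past i o.1) (past i o.2.1) o.2.2 x := by
    rw [sum_comm, mul_sum]
    refine sum_le_sum fun x _ => ?_
    rw [← mul_sum, mul_left_comm]
    refine mul_le_mul_of_nonpos_left ?_ (hP.tradeoff.1 x)
    have := henergy x
    rwa [one_div, inv_mul_le_iff₀ hn] at this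
  calc P.n * P.r
      ≤ P.n * (1 / P.n * ∑ i, P.ξ (o.1 i) (o.2.1 i) + ∑ x, P.γ x * P.ωavg x) :=
        mul_le_mul_of_nonneg_left hpass hn.le
    _ = ∑ i, P.ξ (o.1 i) (o.2.1 i) + P.n * ∑ x, P.γ x * P.ωavg x := by
        rw [mul_add, ← mul_assoc, mul_one_div_cancel hn.ne', one_mul]
    _ ≤ _ := add_le_add_right hγ _

theorem outputProb_le (hP : P.Valid) {o : Run P.n L} (h0 : 0 ≤ outputProb E o)
    (hpass : o ∈ P.pass L) (henergy : o ∈ energyEvent ω P.ωavg)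
    (hscore : P.totalScore E ω o ≤ P.n * P.t) :
    outputProb E o ≤ (2 : ℝ) ^ (-P.σh) * P.εm := by
  rw [hP.two_rpow_neg_σh_mul_εm]
  rcases h0.eq_or_lt with h0 | h0
  · rw [← h0]
    positivity
  rw [← logb_le_iff_le_rpow one_lt_two h0]
  have hthreshold := hP.mul_r_le_sum_ξ_add hpass henergy
  rw [totalScore_eq h0.ne'] at hscore
  linarith

end Valid

/-! ### Soundness -/

theorem κ_mul_TV_eq (μ : PMF (Run P.n L)) (hκ : 0 < P.κ μ) :
    P.κ μ * TV (P.realMass μ) (P.idealMass μ)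
      = TV (fun z : (Bits P.σ × Bits P.l) × ((Fin P.n → Fin 2) × L) =>
          prob (withSeed μ P.l) {q | P.ext q.1.1 q.2 = z.1.1 ∧ q.2 = z.1.2
            ∧ q.1 ∈ P.pass L ∩ Prod.snd ⁻¹' {z.2}})
        fun z => unifMass (Bits P.σ × Bits P.l) * prob μ (P.pass L ∩ Prod.snd ⁻¹' {z.2}) := by
  have hκ' : prob (withSeed μ P.l) {q | q.1 ∈ P.pass L} = P.κ μ := prob_withSeed_fst μ _
  rw [mul_TV hκ.le, ← TV_comp_equiv (Equiv.prodAssoc _ _ _)]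
  congr 1 <;> ext z
  · rw [realMass, ← hκ', prob_mul_condProb _ _ (hκ'.trans_ne hκ.ne')]
    congr 1
    ext q
    exact ⟨fun h => ⟨h.1.1, h.1.2.1, h.2, h.1.2.2⟩, fun h => ⟨⟨h.1, h.2.1, h.2.2.2⟩, h.2.2.1⟩⟩
  · rw [idealMass, mul_left_comm, κ, prob_mul_condProb _ _ hκ.ne', Set.inter_comm]
    rfl

theorem Valid.soundness_of_isRegularDevice (hP : P.Valid) (ht : 0 ≤ P.t)
    (hμ : IsRegularDevice μ E ω P.p P.ωpk P.ωavg P.εω) (hκ : 0 < P.κ μ) :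
    P.κ μ * TV (P.realMass μ) (P.idealMass μ) ≤ P.εExt * P.κ μ + (P.εω + P.εt + P.εm) := by
  set tail : Set (Run P.n L) := {o | P.n * P.t < P.totalScore E ω o}
  have hbad : prob μ (energyEvent ω P.ωavg ∩ tailᶜ)ᶜ ≤ P.εω + P.εt := by
    rw [Set.compl_inter, compl_compl]
    refine (prob_union_le μ _ _).trans (add_le_add ?_ (hP.prob_lt_totalScore_le ht hμ))
    rw [prob_compl]
    linarith [hμ.max_avg]
  have hguess (a : Bits P.n) (y : (Fin P.n → Fin 2) × L) :
      prob μ (P.pass L ∩ (energyEvent ω P.ωavg ∩ tailᶜ) ∩ Prod.snd ⁻¹' {y} ∩ Prod.fst ⁻¹' {a})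
        ≤ 2 ^ (-P.σh) * P.εm * prob μ (Prod.snd ⁻¹' {y}) := by
    by_cases hgood : (a, y) ∈ P.pass L ∩ (energyEvent ω P.ωavg ∩ tailᶜ)
    · calc _ ≤ prob μ {(a, y)} := prob_mono μ fun o ho => Prod.ext ho.2 ho.1.2
        _ = outputProb E (a, y) * prob μ (Prod.snd ⁻¹' {y}) := hμ.prob_singleton _
        _ ≤ _ := mul_le_mul_of_nonneg_right (hP.outputProb_le
            (prod_nonneg fun _ _ => outProb_nonneg (hμ.abs_le_one _ _ _ _ _) _)
            hgood.1 hgood.2.1 (not_lt.1 hgood.2.2)) (prob_nonneg μ _)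
    · refine (prob_mono μ (T := ∅) ?_).trans ?_
      · rintro o ⟨⟨ho, rfl⟩, rfl⟩
        exact hgood ho
      · rw [prob, MeasureTheory.measure_empty]
        exact mul_nonneg (mul_nonneg (by positivity) hP.εm_pos.le) (prob_nonneg μ _)
  have hTV := hP.extractor.TV_withSeed_le hP.εExt_pos.le hP.εm_pos.le μ Prod.fst Prod.snd hguess
  rw [κ_mul_TV_eq μ hκ]
  exact hTV.trans (by rw [κ]; linarith)

theorem Valid.soundness (hP : P.Valid) (ht : 0 ≤ P.t)
    (hμ : DeviceAssumptions μ E ω P.p P.ωpk P.ωavg P.εω) (hκ : 0 < P.κ μ) :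
    P.κ μ * TV (P.realMass μ) (P.idealMass μ) ≤ P.εExt * P.κ μ + (P.εω + P.εt + P.εm) :=
  hP.soundness_of_isRegularDevice ht
    (hμ.isRegularDevice (fun x => (hP.p_pos x).ne') (hP.avg_nonneg.trans hP.avg_le_pk)) hκ

end Args

end EnergyQRNG

theorem theorem5 {L : Type*} (P : EnergyQRNG.Args) (hP : P.Valid) (ht : 0 ≤ P.t)
    (μ : PMF (EnergyQRNG.Run P.n L)) (E ω : EnergyQRNG.RoundFun P.n L)
    (hμ : EnergyQRNG.DeviceAssumptions μ E ω P.p P.ωpk P.ωavg P.εω) :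
    (0 < P.κ μ →
      EnergyQRNG.TV (P.realMass μ) (P.idealMass μ)
          ≤ P.εExt + (P.εω + P.εt + P.εm) / P.κ μ ∧
        P.εExt + (P.εω + P.εt + P.εm) / P.κ μ ≤ P.ε / P.κ μ) ∧
    P.κ μ * EnergyQRNG.TV (P.realMass μ) (P.idealMass μ) ≤ P.ε := by
  have hκ1 : P.κ μ ≤ 1 := EnergyQRNG.prob_le_one μ _
  have hεκ : P.εExt * P.κ μ ≤ P.εExt := mul_le_of_le_one_right hP.εExt_pos.le hκ1
  have hε : P.ε = P.εExt + (P.εω + P.εt + P.εm) := by rw [EnergyQRNG.Args.ε]; ring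
  refine ⟨fun hκ => ⟨?_, ?_⟩, ?_⟩
  · rw [add_div' _ _ _ hκ.ne', le_div_iff₀ hκ, mul_comm]
    exact hP.soundness ht hμ hκ
  · rw [add_div' _ _ _ hκ.ne', hε]
    gcongr
  · rcases (EnergyQRNG.prob_nonneg μ (P.pass L)).eq_or_lt with h0 | hκ
    · rw [EnergyQRNG.Args.κ, ← h0, zero_mul, hε]
      linarith [hP.εExt_pos, hP.εt_pos, hP.εm_pos, hP.εω_nonneg]
    · exact (hP.soundness ht hμ hκ).trans (by linarith)
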